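/- **Theorem 1.1.** For complex $q$ with $|q|<1$ let $$R(q)=\cfrac{q^{1/5}}{1+\cfrac{q}{1+\cfrac{q^2}{1+\cfrac{q^3}{1+\cdots}}}}$$ be the Rogers–Ramanujan continued fraction, where a fifth root $t=q^{1/5}$ of $q$ is fixed and $(q^n)^{1/5}$ is taken to be $t^n$ in $R(q^n)$, $n\ge 1$. Then for every $q$ with $|q|<1$ and every choice of $t$ the continued fractions in $R(q^n)$, $n\ge1$, converge, and $$R(q)R(q^4)=\frac{R(q^5)+R(q^{20})-R(q^5)R(q^{20})}{1+R(q^5)+R(q^{20})}.$$ If moreover $q\neq 0$, then $$\frac{R^2(q)R(q^2)}{R(q^4)}=R(q^5)\,\frac{R(q^{10})-R(q^5)R(q^{10})+R(q^{20})}{R(q^5)R(q^{10})+R(q^{20})+R(q^5)R(q^{20})}$$ and $$\frac{1}{R(q)R^2(q^2)}-R(q)R^2(q^2)=\frac{N}{D},$$ where $$D=R(q^5)\left(1+R(q^5)R^2(q^{10})-R^2(q^5)R^4(q^{10})\right)$$ and $$\begin{aligned}N={}&1+R(q^5)+R^2(q^5)+2R(q^5)R(q^{10})+2R^2(q^5)R(q^{10})-2R(q^5)R^2(q^{10})\\&+2R^3(q^5)R^2(q^{10})-2R^2(q^5)R^3(q^{10})+2R^3(q^5)R^3(q^{10})+R^2(q^5)R^4(q^{10})\\&-R^3(q^5)R^4(q^{10})+R^4(q^5)R^4(q^{10}).\end{aligned}$$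 All denominators in these identities are non-zero. -/

import Mathlib

open Filter Topology

/-- The generalized continued fraction `0 + 1/(1 + q/(1 + q²/(1 + q³/(1 + ⋯))))`: its `n`-th
partial numerator is `q ^ n` (for `n = 0, 1, 2, …`), and all its partial denominators are `1`. -/
noncomputable def rrFraction (q : ℂ) : GenContFract ℂ :=
  ⟨0, Stream'.Seq.ofStream (fun n : ℕ => (⟨q ^ n, 1⟩ : GenContFract.Pair ℂ))⟩

/-- The value of `1/(1 + q/(1 + q²/(1 + q³/(1 + ⋯))))`, that is, the limit of its convergents. -/
noncomputable def rrValue (q : ℂ) : ℂ :=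
  limUnder atTop (rrFraction q).convs

/-- The Rogers–Ramanujan continued fraction
`R(q ^ n) = (q ^ n) ^ (1/5) / (1 + q ^ n / (1 + q ^ (2 n) / (1 + ⋯)))`.
Here `t` is a fifth root of `q`, the chosen value of `q ^ (1/5)`, and the fifth root of `q ^ n` is
the one given by this choice, namely `t ^ n`. -/
noncomputable def rrR (q t : ℂ) (n : ℕ) : ℂ :=
  t ^ n * rrValue (q ^ n)

/-- The numerator `N`, as a polynomial in `a = R(q ^ 5)` and `b = R(q ^ 10)`. -/
def rrN (a b : ℂ) : ℂ :=
  1 + a + a ^ 2 + 2 * a * b + 2 * a ^ 2 * b - 2 * a * b ^ 2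
    + 2 * a ^ 3 * b ^ 2 - 2 * a ^ 2 * b ^ 3 + 2 * a ^ 3 * b ^ 3 + a ^ 2 * b ^ 4
    - a ^ 3 * b ^ 4 + a ^ 4 * b ^ 4

/-- The denominator `D`, as a polynomial in `a = R(q ^ 5)` and `b = R(q ^ 10)`. -/
def rrD (a b : ℂ) : ℂ :=
  a * (1 + a * b ^ 2 - a ^ 2 * b ^ 4)

/-!
The proof expresses everything through theta functions.

*From the continued fraction to a product.* Rogers' series `rogersSeries` solves
`F n = F (n + 1) + q ^ (n + 1) F (n + 2)`, has a nonzero limit, and pairs with the numerators and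
denominators of the convergents to a quantity independent of `n`. Hence the convergents tend to
`F 1 / F 0`. Both values are theta series, which the Jacobi triple product `theta_eq_qProd` turns
into products: the fraction has the value `rrProd q = (q, q⁴; q⁵)_∞ / (q², q³; q⁵)_∞`
(`tendsto_rrFraction_rrProd`).

*Three parameters.* Write `f(a, b)` for `ramTheta a b`, and `φ`, `ψ` for the classical theta
functions. The left-hand sides of the three identities are `w = R(q) R(q⁴)`,
`m = R(q)² R(q²) / R(q⁴)` and, up to `x ↦ 1 / x - x`, `k = R(q) R(q²)²`, and
* `(1 - w) / (1 + w) = φ(q⁵) / φ(q)` (`phi_five_mul`),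
* `(1 - m) / (1 + m) = q ψ(q¹⁰) / ψ(q²)` (`psi_ten_mul`),
* `1 / k + 1 - k = ψ(q)² / (q ψ(q⁵)²)` (`psi_sq_mul_paramK`).

The last two come from Schröter's formula, which writes a product of two theta functions as a sum
of two such products, and from `psi_sq`. For the first one, dissecting double theta series along
sublattices of index `5` of `ℤ²` gives a product for `1 + w` and the square of the identity, whose
sign is settled by continuity in `q`.

*The identities.* The `5`-dissections of `φ` and `ψ` (`phi_dissect`, `psi_dissect`) write `φ(q)` and
`ψ(q)` as sums of theta functions of `q⁵`, whose quotients by `φ(q⁵)`, `ψ(q¹⁰)` and `ψ(q²⁵)` are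
rational functions of `R(q⁵)`, `R(q¹⁰)`, `R(q²⁰)`: these quotients are again products, and the
formulas for `1 + w`, `1 + m`, `1 ± k` with `q⁵` in place of `q` evaluate them. Substituting into
the three displayed formulas gives the three identities. The denominators do not vanish because
each of them is a nonzero multiple of a quotient of theta products.
-/

namespace RogersRamanujan

/-! ### Infinite products -/

/-- The infinite `q`-Pochhammer symbol `(x; y)_∞ = ∏_{n ≥ 0} (1 - x y ^ n)`. -/
noncomputable def qProd (x y : ℂ) : ℂ := ∏' n : ℕ, (1 - x * y ^ n)

lemma summable_mul_pow (x : ℂ) {y : ℂ} (hy : ‖y‖ < 1) : Summable fun n : ℕ => -(x * y ^ n) :=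
  ((summable_geometric_of_norm_lt_one hy).mul_left x).neg

lemma multipliable_qProd (x : ℂ) {y : ℂ} (hy : ‖y‖ < 1) :
    Multipliable fun n : ℕ => 1 - x * y ^ n := by
  simpa only [sub_eq_add_neg] using
    Complex.multipliable_one_add_of_summable (summable_mul_pow x hy)

lemma tendsto_qProd (x : ℂ) {y : ℂ} (hy : ‖y‖ < 1) :
    Tendsto (fun m => ∏ n ∈ Finset.range m, (1 - x * y ^ n)) atTop (𝓝 (qProd x y)) :=
  (multipliable_qProd x hy).tendsto_prod_tprod_nat

lemma qProd_ne_zero {x y : ℂ} (hy : ‖y‖ < 1) (h : ∀ n : ℕ, x * y ^ n ≠ 1) : qProd x y ≠ 0 := by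
  have := tprod_one_add_ne_zero_of_summable (f := fun n : ℕ => -(x * y ^ n))
    (fun n => by
      rw [← sub_eq_add_neg]
      exact sub_ne_zero.2 (h n).symm) (summable_mul_pow x hy).norm
  simpa only [qProd, sub_eq_add_neg] using this

lemma qProd_ne_zero_of_norm_lt {x y : ℂ} (hy : ‖y‖ < 1) (hx : ‖x‖ < 1) : qProd x y ≠ 0 := by
  refine qProd_ne_zero hy fun n h => ?_
  have h1 : ‖x * y ^ n‖ < 1 := by
    rw [norm_mul, norm_pow]
    exact mul_lt_one_of_nonneg_of_lt_one_left (norm_nonneg _) hx (pow_le_one₀ (norm_nonneg _) hy.le)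
  rw [h, norm_one] at h1
  exact lt_irrefl _ h1

/-- Splitting a product according to the residue of the index modulo `N`. -/
lemma qProd_split (x : ℂ) {y : ℂ} (hy : ‖y‖ < 1) {N : ℕ} (hN : 0 < N) :
    qProd x y = ∏ i ∈ Finset.range N, qProd (x * y ^ i) (y ^ N) := by
  have hyN : ‖y ^ N‖ < 1 := by
    rw [norm_pow]
    exact pow_lt_one₀ (norm_nonneg _) hy hN.ne'
  have h1 : Tendsto (fun m => ∏ i ∈ Finset.range N, ∏ n ∈ Finset.range m,
      (1 - x * y ^ i * (y ^ N) ^ n)) atTop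
      (𝓝 (∏ i ∈ Finset.range N, qProd (x * y ^ i) (y ^ N))) :=
    tendsto_finsetProd _ fun i _ => tendsto_qProd _ hyN
  have h2 : Tendsto (fun m : ℕ => N * m) atTop atTop := tendsto_id.const_mul_atTop' hN
  refine tendsto_nhds_unique ((tendsto_qProd x hy).comp h2) (h1.congr fun m => ?_)
  simp only [Function.comp_apply]
  induction m with
  | zero => simp
  | succ m ih =>
    rw [mul_add_one, Finset.prod_range_add, ← ih, ← Finset.prod_mul_distrib]
    refine Finset.prod_congr rfl fun i _ => ?_
    rw [Finset.prod_range_succ, mul_assoc x, ← pow_mul, ← pow_add, add_comm i]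

lemma qProd_mul_qProd_neg (x : ℂ) {y : ℂ} (hy : ‖y‖ < 1) :
    qProd x y * qProd (-x) y = qProd (x ^ 2) (y ^ 2) := by
  rw [qProd, qProd, ← (multipliable_qProd x hy).tprod_mul (multipliable_qProd (-x) hy), qProd]
  exact tprod_congr fun n => by ring

lemma continuousOn_qProd (c : ℂ) (i : ℕ) {N : ℕ} (hN : 0 < N) :
    ContinuousOn (fun q : ℂ => qProd (c * q ^ i) (q ^ N)) (Metric.ball 0 1) := by
  intro q hq
  refine ContinuousAt.continuousWithinAt ?_
  rw [mem_ball_zero_iff] at hq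
  obtain ⟨r, hqr, hr⟩ := exists_between hq
  have hr0 : 0 ≤ r := (norm_nonneg q).trans hqr.le
  have key := tendsto_tprod_one_add_of_dominated_convergence (𝓕 := 𝓝 q)
    (f := fun (q : ℂ) (n : ℕ) => -(c * q ^ i * (q ^ N) ^ n))
    (g := fun n : ℕ => -(c * q ^ i * (q ^ N) ^ n)) (bound := fun n : ℕ => ‖c‖ * r ^ n)
    ((summable_geometric_of_lt_one hr0 hr).mul_left _)
    (fun n => Continuous.tendsto (by fun_prop) q) ?_
  · simpa only [ContinuousAt, qProd, sub_eq_add_neg] using key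
  · have hnear : ∀ᶠ z : ℂ in 𝓝 q, ‖z‖ < r :=
      continuous_norm.continuousAt.eventually_lt continuousAt_const hqr
    filter_upwards [hnear] with z hz n
    rw [norm_neg, norm_mul, norm_mul, norm_pow, norm_pow, norm_pow, mul_assoc]
    refine mul_le_mul_of_nonneg_left ?_ (norm_nonneg _)
    calc ‖z‖ ^ i * (‖z‖ ^ N) ^ n ≤ 1 * r ^ n := by
          refine mul_le_mul (pow_le_one₀ (norm_nonneg _) (hz.trans hr).le) ?_ (by positivity)
            zero_le_one
          refine pow_le_pow_left₀ (by positivity) ?_ _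
          calc ‖z‖ ^ N ≤ ‖z‖ ^ 1 := pow_le_pow_of_le_one (norm_nonneg _) (hz.trans hr).le hN
            _ ≤ r := by rw [pow_one]; exact hz.le
      _ = r ^ n := one_mul _

/-! ### Theta series -/

/-- The theta series `∑_{n ∈ ℤ} z ^ n p ^ (n ^ 2)`. -/
noncomputable def theta (z p : ℂ) : ℂ := ∑' n : ℤ, z ^ n * p ^ (n ^ 2)

lemma summable_pow_mul_pow_sq (x : ℝ) (hx : 0 ≤ x) {r : ℝ} (hr0 : 0 < r) (hr : r < 1) :
    Summable fun n : ℕ => x ^ n * r ^ (n ^ 2) := by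
  have h0 : Tendsto (fun n : ℕ => x * r ^ n) atTop (𝓝 (x * 0)) :=
    (tendsto_pow_atTop_nhds_zero_of_lt_one hr0.le hr).const_mul x
  rw [mul_zero] at h0
  have h1 : ∀ᶠ n : ℕ in atTop, x * r ^ n ≤ 1 / 2 :=
    (h0.eventually_lt_const (by norm_num)).mono fun _ h => le_of_lt h
  refine Summable.of_norm_bounded_eventually_nat (g := fun n : ℕ => (1 / 2 : ℝ) ^ n)
    (summable_geometric_of_lt_one (by norm_num) (by norm_num)) ?_
  filter_upwards [h1] with n hn
  rw [Real.norm_of_nonneg (by positivity), sq, pow_mul, ← mul_pow]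
  exact pow_le_pow_left₀ (by positivity) hn n

lemma summable_norm_theta (z : ℂ) {p : ℂ} (hp0 : p ≠ 0) (hp : ‖p‖ < 1) :
    Summable fun n : ℤ => ‖z ^ n * p ^ (n ^ 2)‖ := by
  have hp0' : 0 < ‖p‖ := norm_pos_iff.2 hp0
  refine Summable.of_nat_of_neg ?_ ?_
  · refine (summable_pow_mul_pow_sq ‖z‖ (norm_nonneg _) hp0' hp).congr fun n => ?_
    rw [norm_mul, norm_zpow, norm_zpow, zpow_natCast]
    congr 1
  · refine (summable_pow_mul_pow_sq ‖z⁻¹‖ (norm_nonneg _) hp0' hp).congr fun n => ?_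
    rw [norm_mul, norm_zpow, norm_zpow, neg_sq, zpow_neg, zpow_natCast, norm_inv, inv_pow]
    congr 1

lemma hasSum_theta (z : ℂ) {p : ℂ} (hp0 : p ≠ 0) (hp : ‖p‖ < 1) :
    HasSum (fun n : ℤ => z ^ n * p ^ (n ^ 2)) (theta z p) :=
  (summable_norm_theta z hp0 hp).of_norm.hasSum

lemma hasSum_mul_of_summable_norm {f g : ℤ → ℂ} {a b : ℂ} (hf : HasSum f a) (hg : HasSum g b)
    (hf' : Summable fun n => ‖f n‖) (hg' : Summable fun n => ‖g n‖) :
    HasSum (fun n : ℤ × ℤ => f n.1 * g n.2) (a * b) :=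
  hf.mul hg (summable_mul_of_summable_norm hf' hg')

/-- The product of two theta series, as an absolutely convergent sum over `ℤ × ℤ`. -/
lemma hasSum_theta_mul_theta (z w : ℂ) {p r : ℂ} (hp0 : p ≠ 0) (hp : ‖p‖ < 1) (hr0 : r ≠ 0)
    (hr : ‖r‖ < 1) :
    HasSum (fun n : ℤ × ℤ => (z ^ n.1 * p ^ (n.1 ^ 2)) * (w ^ n.2 * r ^ (n.2 ^ 2)))
      (theta z p * theta w r) := by
  exact hasSum_mul_of_summable_norm (f := fun n : ℤ => z ^ n * p ^ (n ^ 2))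
    (g := fun n : ℤ => w ^ n * r ^ (n ^ 2)) (hasSum_theta z hp0 hp) (hasSum_theta w hr0 hr)
    (summable_norm_theta z hp0 hp) (summable_norm_theta w hr0 hr)

lemma theta_inv (z p : ℂ) : theta z⁻¹ p = theta z p := by
  rw [theta, ← (Equiv.neg ℤ).tsum_eq]
  exact tsum_congr fun n => by simp

/-- The quasi-periodicity of the theta series. -/
lemma theta_mul_sq {z p : ℂ} (hz : z ≠ 0) (hp0 : p ≠ 0) :
    z * p * theta (z * p ^ 2) p = theta z p := by
  rw [theta, theta, ← tsum_mul_left,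
    ← (Equiv.addRight (1 : ℤ)).tsum_eq (fun n => z ^ n * p ^ n ^ 2)]
  refine tsum_congr fun n => ?_
  simp only [Equiv.coe_addRight]
  rw [mul_zpow, ← zpow_natCast p 2, ← zpow_mul, zpow_add_one₀ hz,
    show (n + 1) ^ 2 = 1 + ((2 : ℕ) : ℤ) * n + n ^ 2 by push_cast; ring, zpow_add₀ hp0,
    zpow_add₀ hp0, zpow_one]
  ring

/-! ### The Jacobi triple product -/

/-- The finite `q`-Pochhammer symbol `(y; y)_m = (1 - y) (1 - y ^ 2) ⋯ (1 - y ^ m)`. -/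
noncomputable def qFact (y : ℂ) (m : ℕ) : ℂ := ∏ n ∈ Finset.range m, (1 - y * y ^ n)

lemma qFact_succ (y : ℂ) (m : ℕ) : qFact y (m + 1) = qFact y m * (1 - y ^ (m + 1)) := by
  rw [qFact, Finset.prod_range_succ, ← qFact, pow_succ']

lemma one_sub_pow_ne_zero {y : ℂ} (hy : ‖y‖ < 1) {n : ℕ} (hn : n ≠ 0) : 1 - y ^ n ≠ 0 := by
  intro h
  have h1 : ‖y ^ n‖ < 1 := by
    rw [norm_pow]
    exact pow_lt_one₀ (norm_nonneg _) hy hn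
  rw [← sub_eq_zero.1 h, norm_one] at h1
  exact lt_irrefl _ h1

lemma qFact_ne_zero {y : ℂ} (hy : ‖y‖ < 1) (m : ℕ) : qFact y m ≠ 0 := by
  refine Finset.prod_ne_zero_iff.2 fun n _ => ?_
  rw [← pow_succ']
  exact one_sub_pow_ne_zero hy n.succ_ne_zero

lemma tendsto_qFact {y : ℂ} (hy : ‖y‖ < 1) : Tendsto (qFact y) atTop (𝓝 (qProd y y)) :=
  tendsto_qProd y hy

lemma exists_norm_qFact_le {y : ℂ} (hy : ‖y‖ < 1) : ∃ M, ∀ m, ‖qFact y m‖ ≤ M := by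
  obtain ⟨M, hM⟩ := (tendsto_qFact hy).norm.bddAbove_range
  exact ⟨M, fun m => hM ⟨m, rfl⟩⟩

lemma exists_norm_inv_qFact_le {y : ℂ} (hy : ‖y‖ < 1) : ∃ M, ∀ m, ‖(qFact y m)⁻¹‖ ≤ M := by
  obtain ⟨M, hM⟩ :=
    ((tendsto_qFact hy).inv₀ (qProd_ne_zero_of_norm_lt hy hy)).norm.bddAbove_range
  exact ⟨M, fun m => hM ⟨m, rfl⟩⟩

/-- `1 / (y; y)_k`, extended by `0` to negative `k`. -/
noncomputable def invQFact (y : ℂ) (k : ℤ) : ℂ := if k < 0 then 0 else (qFact y k.toNat)⁻¹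

/-- With the convention that `1 / (y; y)_k` vanishes for negative `k`, its recurrence holds for all
integers. -/
lemma invQFact_sub_one {y : ℂ} (hy : ‖y‖ < 1) (k : ℤ) :
    invQFact y (k - 1) = (1 - y ^ k) * invQFact y k := by
  rcases lt_trichotomy k 0 with hk | rfl | hk
  · simp [invQFact, hk, show k - 1 < 0 by lia]
  · simp [invQFact]
  · obtain ⟨m, rfl⟩ : ∃ m : ℕ, k = m + 1 := ⟨(k - 1).toNat, by lia⟩
    have h1 := one_sub_pow_ne_zero hy m.succ_ne_zero
    have h2 : ((m : ℤ) + 1).toNat = m + 1 := by lia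
    rw [invQFact, invQFact, if_neg (by lia), if_neg (by lia), h2, add_sub_cancel_right,
      Int.toNat_natCast, qFact_succ, mul_inv, ← Nat.cast_add_one,
      zpow_natCast]
    field_simp

/-- The coefficient of `z ^ k` in `∏_{i < n} (1 + z p ^ (2 i + 1)) (1 + z⁻¹ p ^ (2 i + 1))`. -/
noncomputable def tripleCoeff (p : ℂ) (n : ℕ) (k : ℤ) : ℂ :=
  p ^ (k ^ 2) * (qFact (p ^ 2) (2 * n) * (invQFact (p ^ 2) (n + k) * invQFact (p ^ 2) (n - k)))

/-- The recurrence of `tripleCoeff` in `n`, which is multiplication by the factor with `i = n`. -/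
lemma tripleCoeff_succ {p : ℂ} (hp0 : p ≠ 0) (hp : ‖p ^ 2‖ < 1) (n : ℕ) (k : ℤ) :
    tripleCoeff p (n + 1) k = tripleCoeff p n k * (1 + p ^ (4 * n + 2)) +
      p ^ (2 * n + 1) * (tripleCoeff p n (k - 1) + tripleCoeff p n (k + 1)) := by
  have hy : p ^ 2 ≠ 0 := pow_ne_zero 2 hp0
  have e1 : invQFact (p ^ 2) (n + k) = (1 - (p ^ 2) ^ ((n : ℤ) + 1 + k)) *
      invQFact (p ^ 2) (n + 1 + k) := by
    rw [← invQFact_sub_one hp]; congr 1; ring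
  have e2 : invQFact (p ^ 2) (n - k) = (1 - (p ^ 2) ^ ((n : ℤ) + 1 - k)) *
      invQFact (p ^ 2) (n + 1 - k) := by
    rw [← invQFact_sub_one hp]; congr 1; ring
  have e3 : invQFact (p ^ 2) (n + (k - 1)) = (1 - (p ^ 2) ^ ((n : ℤ) + k)) *
      invQFact (p ^ 2) (n + k) := by
    rw [← invQFact_sub_one hp]; congr 1; ring
  have e4 : invQFact (p ^ 2) (n - (k + 1)) = (1 - (p ^ 2) ^ ((n : ℤ) - k)) *
      invQFact (p ^ 2) (n - k) := by
    rw [← invQFact_sub_one hp]; congr 1; ring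
  have e5 : (n : ℤ) - (k - 1) = n + 1 - k := by ring
  have e6 : (n : ℤ) + (k + 1) = n + 1 + k := by ring
  have f1 : (p ^ 2) ^ ((n : ℤ) + 1 + k) = p ^ (2 * n + 2) * p ^ k * p ^ k := by
    rw [zpow_add₀ hy, ← Nat.cast_add_one, zpow_natCast, ← zpow_natCast p 2, ← zpow_mul,
      mul_comm _ k, zpow_mul, zpow_natCast, zpow_natCast]
    ring
  have f2 : (p ^ 2) ^ ((n : ℤ) + 1 - k) = p ^ (2 * n + 2) / p ^ k / p ^ k := by
    rw [zpow_sub₀ hy, ← Nat.cast_add_one, zpow_natCast, ← zpow_natCast p 2, ← zpow_mul,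
      mul_comm _ k, zpow_mul, zpow_natCast, zpow_natCast]
    field_simp
    ring
  have f3 : (p ^ 2) ^ ((n : ℤ) + k) = p ^ (2 * n) * p ^ k * p ^ k := by
    rw [zpow_add₀ hy, zpow_natCast, ← zpow_natCast p 2, ← zpow_mul,
      mul_comm _ k, zpow_mul, zpow_natCast, zpow_natCast]
    ring
  have f4 : (p ^ 2) ^ ((n : ℤ) - k) = p ^ (2 * n) / p ^ k / p ^ k := by
    rw [zpow_sub₀ hy, zpow_natCast, ← zpow_natCast p 2, ← zpow_mul,
      mul_comm _ k, zpow_mul, zpow_natCast, zpow_natCast]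
    field_simp
    ring
  have g1 : p ^ ((k - 1) ^ 2) = p ^ (k ^ 2) * p / p ^ k / p ^ k := by
    rw [show (k - 1) ^ 2 = k ^ 2 + 1 - k - k by ring, zpow_sub₀ hp0, zpow_sub₀ hp0, zpow_add₀ hp0,
      zpow_one]
  have g2 : p ^ ((k + 1) ^ 2) = p ^ (k ^ 2) * p * p ^ k * p ^ k := by
    rw [show (k + 1) ^ 2 = k ^ 2 + 1 + k + k by ring, zpow_add₀ hp0, zpow_add₀ hp0, zpow_add₀ hp0,
      zpow_one]
  have h1 : qFact (p ^ 2) (2 * (n + 1)) =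
      qFact (p ^ 2) (2 * n) * (1 - (p ^ 2) ^ (2 * n + 1)) * (1 - (p ^ 2) ^ (2 * n + 2)) := by
    rw [show 2 * (n + 1) = 2 * n + 1 + 1 by ring, qFact_succ, qFact_succ]
  have hpk : p ^ k ≠ 0 := zpow_ne_zero _ hp0
  simp only [tripleCoeff]
  rw [h1, e3, e4, e5, e6, e1, e2, f1, f2, f3, f4, g1, g2]
  push_cast
  field_simp
  ring

/-- The finite Jacobi triple product, as a sum over `ℤ` with finitely many nonzero terms. -/
lemma hasSum_tripleCoeff {z p : ℂ} (hz : z ≠ 0) (hp0 : p ≠ 0) (hp : ‖p ^ 2‖ < 1) (n : ℕ) :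
    HasSum (fun k : ℤ => z ^ k * tripleCoeff p n k)
      (∏ i ∈ Finset.range n, (1 + z * p ^ (2 * i + 1)) * (1 + z⁻¹ * p ^ (2 * i + 1))) := by
  induction n with
  | zero =>
    have h := hasSum_ite_eq (0 : ℤ) (1 : ℂ)
    rw [Finset.range_zero, Finset.prod_empty]
    refine h.congr_fun fun k => ?_
    rcases lt_trichotomy k 0 with hk | rfl | hk
    · simp [tripleCoeff, invQFact, hk, hk.ne]
    · simp [tripleCoeff, invQFact, qFact]
    · simp [tripleCoeff, invQFact, hk, hk.ne']
  | succ n ih =>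
    have h1 := (Equiv.subRight (1 : ℤ)).hasSum_iff.2 ih
    have h2 := (Equiv.addRight (1 : ℤ)).hasSum_iff.2 ih
    have h := (ih.mul_right (1 + p ^ (4 * n + 2))).add
      (((h1.mul_left z).add (h2.mul_left z⁻¹)).mul_right (p ^ (2 * n + 1)))
    rw [Finset.prod_range_succ]
    convert! h using 1
    · funext k
      simp only [Function.comp_apply, Equiv.subRight_apply, Equiv.coe_addRight]
      rw [tripleCoeff_succ hp0 hp, zpow_sub_one₀ hz, zpow_add_one₀ hz]
      field_simp
    · field_simp
      ring

lemma tendsto_invQFact {y : ℂ} (hy : ‖y‖ < 1) {f : ℕ → ℤ} (hf : Tendsto f atTop atTop) :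
    Tendsto (fun n => invQFact y (f n)) atTop (𝓝 (qProd y y)⁻¹) := by
  have h1 : Tendsto (fun n => (f n).toNat) atTop atTop :=
    tendsto_atTop.2 fun b => (hf.eventually_ge_atTop (b : ℤ)).mono fun n hn => by lia
  refine (((tendsto_qFact hy).comp h1).inv₀ (qProd_ne_zero_of_norm_lt hy hy)).congr' ?_
  filter_upwards [hf.eventually_ge_atTop 0] with n hn
  rw [invQFact, if_neg (by lia)]
  rfl

/-- The **Jacobi triple product**. The finite version, whose coefficients are `q`-binomial
coefficients, converges to it term by term, under a dominating series. -/
theorem theta_eq_qProd {z p : ℂ} (hz : z ≠ 0) (hp0 : p ≠ 0) (hp : ‖p‖ < 1) :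
    theta z p = qProd (p ^ 2) (p ^ 2) * qProd (-(z * p)) (p ^ 2) * qProd (-(p / z)) (p ^ 2) := by
  have hy : ‖p ^ 2‖ < 1 := by
    rw [norm_pow]
    exact pow_lt_one₀ (norm_nonneg _) hp two_ne_zero
  have hE := qProd_ne_zero_of_norm_lt hy hy
  obtain ⟨M, hM⟩ := exists_norm_qFact_le hy
  obtain ⟨K, hK⟩ := exists_norm_inv_qFact_le hy
  have hK0 : 0 ≤ K := (norm_nonneg _).trans (hK 0)
  have hK' : ∀ k, ‖invQFact (p ^ 2) k‖ ≤ K := by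
    intro k
    rw [invQFact]
    split_ifs
    · simpa using hK0
    · exact hK _
  have hlim : Tendsto (fun n : ℕ => ∑' k : ℤ, z ^ k * tripleCoeff p n k) atTop
      (𝓝 (∑' k : ℤ, z ^ k * (p ^ (k ^ 2) *
        (qProd (p ^ 2) (p ^ 2) * ((qProd (p ^ 2) (p ^ 2))⁻¹ * (qProd (p ^ 2) (p ^ 2))⁻¹))))) := by
    refine tendsto_tsum_of_dominated_convergence
      ((summable_norm_theta z hp0 hp).mul_right (M * (K * K))) (fun k => ?_)
      (Eventually.of_forall fun n k => ?_)
    · refine ((Tendsto.mul ?_ (Tendsto.mul ?_ ?_)).const_mul _).const_mul _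
      · exact (tendsto_qFact hy).comp (tendsto_id.const_mul_atTop' two_pos)
      · exact tendsto_invQFact hy (tendsto_natCast_atTop_atTop.atTop_add tendsto_const_nhds)
      · simp only [sub_eq_add_neg]
        exact tendsto_invQFact hy (tendsto_natCast_atTop_atTop.atTop_add tendsto_const_nhds)
    · rw [tripleCoeff, ← mul_assoc, norm_mul, norm_mul (qFact _ _), norm_mul (invQFact _ _)]
      refine mul_le_mul_of_nonneg_left ?_ (norm_nonneg _)
      exact mul_le_mul (hM _) (mul_le_mul (hK' _) (hK' _) (norm_nonneg _) hK0) (by positivity)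
        ((norm_nonneg _).trans (hM 0))
  have hprod : Tendsto (fun n : ℕ => ∑' k : ℤ, z ^ k * tripleCoeff p n k) atTop
      (𝓝 (qProd (-(z * p)) (p ^ 2) * qProd (-(p / z)) (p ^ 2))) := by
    refine ((tendsto_qProd _ hy).mul (tendsto_qProd _ hy)).congr fun n => ?_
    rw [(hasSum_tripleCoeff hz hp0 hy n).tsum_eq, ← Finset.prod_mul_distrib]
    refine Finset.prod_congr rfl fun i _ => ?_
    ring
  have key := tendsto_nhds_unique hlim hprod
  rw [mul_assoc, ← key, ← tsum_mul_left, theta]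
  refine tsum_congr fun k => ?_
  field_simp

/-- Ramanujan's theta function `f(a, b) = ∑_{n ∈ ℤ} a ^ (n (n + 1) / 2) b ^ (n (n - 1) / 2)`,
defined as the product `(ab; ab)_∞ (-a; ab)_∞ (-b; ab)_∞`; `theta_eq_ramTheta` relates it to its
series. -/
noncomputable def ramTheta (a b : ℂ) : ℂ :=
  qProd (a * b) (a * b) * qProd (-a) (a * b) * qProd (-b) (a * b)

lemma ramTheta_comm (a b : ℂ) : ramTheta a b = ramTheta b a := by
  rw [ramTheta, ramTheta, mul_comm b a]
  ring

lemma theta_eq_ramTheta {z p a b : ℂ} (hz : z ≠ 0) (hp0 : p ≠ 0) (hp : ‖p‖ < 1) (ha : z * p = a)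
    (hb : p = b * z) : theta z p = ramTheta a b := by
  have h1 : p / z = b := by rw [hb, mul_div_cancel_right₀ _ hz]
  have h2 : p ^ 2 = a * b := by rw [← ha, ← h1]; field_simp
  rw [theta_eq_qProd hz hp0 hp, ha, h1, h2, ramTheta]

/-! ### The Rogers-Ramanujan recurrence -/

/-- General term of `rogersSeries`. -/
noncomputable def rogersTerm (s : ℂ) (n r : ℕ) : ℂ :=
  (-1) ^ r * s ^ (5 * r ^ 2 + r + 4 * r * n) * (1 - s ^ (4 * n + 4 + 8 * r)) *
    (qFact (s ^ 2) (n + r) * (qFact (s ^ 2) r)⁻¹)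

/-- Rogers' solution of `F n = F (n + 1) + q ^ (n + 1) F (n + 2)`, where `q = s ^ 2`: with
`a = q ^ (n + 1)` it is `(q; q)_∞` times
`∑_r (-1) ^ r a ^ (2 r) q ^ (r (5 r - 3) / 2) (1 - a ^ 2 q ^ (4 r)) / ((q; q)_r (a q ^ r; q)_∞)`.
The square root `s` of `q` avoids the division by `2` in the exponent. -/
noncomputable def rogersSeries (s : ℂ) (n : ℕ) : ℂ := ∑' r : ℕ, rogersTerm s n r

/-- General term of a second expansion of `rogersSeries s (n + 1)`, which mediates the
recurrence. -/
noncomputable def rogersTermAux (s : ℂ) (n r : ℕ) : ℂ :=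
  (-1) ^ r * s ^ (5 * r ^ 2 + 3 * r + 4 * r * n) * (1 - s ^ (2 * n + 2 + 4 * r)) *
    (qFact (s ^ 2) (n + r) * (qFact (s ^ 2) r)⁻¹)

lemma norm_sq_lt_one {s : ℂ} (hs : ‖s‖ < 1) : ‖s ^ 2‖ < 1 := by
  rw [norm_pow]
  exact pow_lt_one₀ (norm_nonneg _) hs two_ne_zero

/-- A bound for the terms of all the series of this part, uniform in the parameter. -/
lemma exists_norm_term_le {s : ℂ} (hs : ‖s‖ < 1) : ∃ M : ℝ, ∀ n r e g : ℕ, r ≤ e →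
    ‖(-1) ^ r * s ^ e * (1 - s ^ g) * (qFact (s ^ 2) (n + r) * (qFact (s ^ 2) r)⁻¹)‖ ≤
      ‖s‖ ^ r * M := by
  obtain ⟨M, hM⟩ := exists_norm_qFact_le (norm_sq_lt_one hs)
  obtain ⟨K, hK⟩ := exists_norm_inv_qFact_le (norm_sq_lt_one hs)
  have hM0 : 0 ≤ M := (norm_nonneg _).trans (hM 0)
  refine ⟨2 * (M * K), fun n r e g hre => ?_⟩
  rw [norm_mul, norm_mul, norm_mul, norm_mul, norm_pow, norm_neg, norm_one, one_pow, one_mul,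
    norm_pow, mul_assoc]
  have h1 : ‖s‖ ^ e ≤ ‖s‖ ^ r := pow_le_pow_of_le_one (norm_nonneg _) hs.le hre
  have h2 : ‖1 - s ^ g‖ ≤ 2 := by
    refine (norm_sub_le _ _).trans ?_
    rw [norm_one, norm_pow]
    linarith [pow_le_one₀ (n := g) (norm_nonneg s) hs.le]
  exact mul_le_mul h1 (mul_le_mul h2 (mul_le_mul (hM _) (hK _) (norm_nonneg _) hM0)
    (by positivity) zero_le_two) (by positivity) (by positivity)

lemma summable_term {s : ℂ} (hs : ‖s‖ < 1) (n : ℕ) {e g : ℕ → ℕ} (he : ∀ r, r ≤ e r) :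
    Summable fun r : ℕ => (-1) ^ r * s ^ e r * (1 - s ^ g r) *
      (qFact (s ^ 2) (n + r) * (qFact (s ^ 2) r)⁻¹) := by
  obtain ⟨M, hM⟩ := exists_norm_term_le hs
  exact Summable.of_norm_bounded
    ((summable_geometric_of_lt_one (norm_nonneg s) hs).mul_right M) fun r => hM n r _ _ (he r)

lemma summable_rogersTerm {s : ℂ} (hs : ‖s‖ < 1) (n : ℕ) : Summable (rogersTerm s n) :=
  summable_term hs n fun r => by lia

lemma summable_rogersTermAux {s : ℂ} (hs : ‖s‖ < 1) (n : ℕ) : Summable (rogersTermAux s n) :=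
  summable_term hs n fun r => by lia

lemma tsum_sub_succ_eq_zero {w : ℕ → ℂ} (hw : Summable w) (h0 : w 0 = 0) :
    ∑' r, (w r - w (r + 1)) = 0 := by
  rw [hw.tsum_sub ((summable_nat_add_iff 1).2 hw), hw.tsum_eq_zero_add, h0, zero_add, sub_self]

/-- The difference of the two expansions telescopes. -/
lemma rogersSeries_succ_eq {s : ℂ} (hs : ‖s‖ < 1) (n : ℕ) :
    rogersSeries s (n + 1) = ∑' r, rogersTermAux s n r := by
  have hw := summable_term hs n (e := fun r => 5 * r ^ 2 + 3 * r + 4 * r * n) (g := fun r => 2 * r)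
    fun r => by lia
  have h := tsum_sub_succ_eq_zero hw (by simp)
  rw [rogersSeries, eq_comm, ← sub_eq_zero,
    ← (summable_rogersTermAux hs n).tsum_sub (summable_rogersTerm hs (n + 1)), ← h]
  refine tsum_congr fun r => ?_
  have h1 := qFact_ne_zero (norm_sq_lt_one hs) r
  have h2 := one_sub_pow_ne_zero (norm_sq_lt_one hs) r.succ_ne_zero
  rw [rogersTermAux, rogersTerm, show n + 1 + r = n + r + 1 by ring, ← add_assoc n r 1, qFact_succ,
    qFact_succ]
  rw [Nat.succ_eq_add_one] at h2
  field_simp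
  ring

/-- The second half of the recurrence; again the difference of both sides telescopes. -/
lemma rogersSeries_sub {s : ℂ} (hs : ‖s‖ < 1) (n : ℕ) :
    rogersSeries s n - ∑' r, rogersTermAux s n r =
      (s ^ 2) ^ (n + 1) * ∑' r, rogersTermAux s (n + 1) r := by
  have hw := summable_term hs n (e := fun r => 5 * r ^ 2 + r + 4 * r * n) (g := fun r => 2 * r)
    fun r => by lia
  have h := tsum_sub_succ_eq_zero hw (by simp)
  rw [← sub_eq_zero, rogersSeries, ← tsum_mul_left,
    ← (summable_rogersTerm hs n).tsum_sub (summable_rogersTermAux hs n),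
    ← ((summable_rogersTerm hs n).sub (summable_rogersTermAux hs n)).tsum_sub
      ((summable_rogersTermAux hs (n + 1)).mul_left _), ← h]
  refine tsum_congr fun r => ?_
  have h1 := qFact_ne_zero (norm_sq_lt_one hs) r
  have h2 := one_sub_pow_ne_zero (norm_sq_lt_one hs) r.succ_ne_zero
  rw [rogersTermAux, rogersTermAux, rogersTerm, show n + 1 + r = n + r + 1 by ring,
    ← add_assoc n r 1, qFact_succ, qFact_succ]
  rw [Nat.succ_eq_add_one] at h2
  field_simp
  ring

lemma rogersSeries_rec {s : ℂ} (hs : ‖s‖ < 1) (n : ℕ) :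
    rogersSeries s n = rogersSeries s (n + 1) + (s ^ 2) ^ (n + 1) * rogersSeries s (n + 2) := by
  rw [rogersSeries_succ_eq hs (n + 1), ← rogersSeries_sub hs n, rogersSeries_succ_eq hs n]
  ring

lemma tendsto_rogersSeries {s : ℂ} (hs : ‖s‖ < 1) :
    Tendsto (rogersSeries s) atTop (𝓝 (qProd (s ^ 2) (s ^ 2))) := by
  obtain ⟨M, hM⟩ := exists_norm_term_le hs
  have hpow : ∀ {f : ℕ → ℕ}, (∀ n, n ≤ f n) → Tendsto (fun n => s ^ f n) atTop (𝓝 0) :=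
    fun hf => (tendsto_pow_atTop_nhds_zero_of_norm_lt_one hs).comp
      (tendsto_atTop_mono hf tendsto_id)
  have key : Tendsto (rogersSeries s) atTop
      (𝓝 (∑' r : ℕ, if r = 0 then qProd (s ^ 2) (s ^ 2) else 0)) := by
    refine tendsto_tsum_of_dominated_convergence
      ((summable_geometric_of_lt_one (norm_nonneg s) hs).mul_right M) (fun r => ?_)
      (Eventually.of_forall fun n r => hM n r _ _ (by lia))
    have h1 : Tendsto (fun n => 1 - s ^ (4 * n + 4 + 8 * r)) atTop (𝓝 (1 - 0)) :=
      tendsto_const_nhds.sub (hpow fun n => by lia)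
    have h2 : Tendsto (fun n => qFact (s ^ 2) (n + r)) atTop (𝓝 (qProd (s ^ 2) (s ^ 2))) :=
      (tendsto_add_atTop_iff_nat r).2 (tendsto_qFact (norm_sq_lt_one hs))
    rcases eq_or_ne r 0 with rfl | hr
    · have := h1.mul h2
      simpa [rogersTerm, qFact] using this
    · have h3 : Tendsto (fun n => s ^ (5 * r ^ 2 + r + 4 * r * n)) atTop (𝓝 0) :=
        hpow fun n => by
          have : n ≤ r * n := Nat.le_mul_of_pos_left n (Nat.pos_of_ne_zero hr)
          nlinarith
      have := ((h3.const_mul ((-1) ^ r)).mul h1).mul (h2.mul_const (qFact (s ^ 2) r)⁻¹)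
      simpa [rogersTerm, hr] using this
  simpa using key

/-! ### The values of the series at the two starting points -/

lemma neg_pow_zpow_mul {s : ℂ} (hs0 : s ≠ 0) (c d e : ℕ) (n : ℤ)
    (he : (e : ℤ) = c * n ^ 2 + d * n) :
    (-s ^ d) ^ n * (s ^ c) ^ (n ^ 2) = (-1) ^ n * s ^ e := by
  rw [neg_eq_neg_one_mul, mul_zpow, ← zpow_natCast s, ← zpow_natCast s, ← zpow_natCast s,
    ← zpow_mul, ← zpow_mul, mul_assoc, ← zpow_add₀ hs0, he, add_comm]

lemma neg_one_zpow_neg_add_one (r : ℕ) : (-1 : ℂ) ^ (-((r : ℤ) + 1)) = -(-1) ^ r := by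
  rw [zpow_neg, ← inv_zpow, zpow_add_one₀ (by norm_num), zpow_natCast]
  norm_num

/-- A theta series with alternating signs, the terms with index `r` and `-r - 1` being combined. -/
lemma theta_neg_pow_eq_tsum {s : ℂ} (hs0 : s ≠ 0) (hs : ‖s‖ < 1) (d k : ℕ) (hk : d + k ≠ 0) :
    theta (-s ^ d) (s ^ (d + k)) =
      ∑' r : ℕ, (-1) ^ r * s ^ ((d + k) * r ^ 2 + d * r) * (1 - s ^ (k + 2 * k * r)) := by
  have hp : ‖s ^ (d + k)‖ < 1 := by
    rw [norm_pow]
    exact pow_lt_one₀ (norm_nonneg _) hs hk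
  rw [← (hasSum_theta (-s ^ d) (pow_ne_zero _ hs0) hp).nat_add_neg_add_one.tsum_eq]
  refine tsum_congr fun r => ?_
  rw [neg_pow_zpow_mul hs0 _ _ ((d + k) * r ^ 2 + d * r) r (by push_cast; ring),
    neg_pow_zpow_mul hs0 _ _ ((d + k) * r ^ 2 + d * r + (k + 2 * k * r)) _ (by push_cast; ring),
    neg_one_zpow_neg_add_one, zpow_natCast, pow_add s _ (k + 2 * k * r)]
  ring

lemma rogersSeries_zero {s : ℂ} (hs0 : s ≠ 0) (hs : ‖s‖ < 1) :
    rogersSeries s 0 = theta (-s ^ 1) (s ^ 5) := by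
  rw [theta_neg_pow_eq_tsum hs0 hs 1 4 (by norm_num)]
  refine tsum_congr fun r => ?_
  have h1 := qFact_ne_zero (norm_sq_lt_one hs) r
  rw [rogersTerm, zero_add, mul_inv_cancel₀ h1]
  ring_nf

lemma rogersSeries_one {s : ℂ} (hs0 : s ≠ 0) (hs : ‖s‖ < 1) :
    rogersSeries s 1 = theta (-s ^ 3) (s ^ 5) := by
  rw [rogersSeries_succ_eq hs, theta_neg_pow_eq_tsum hs0 hs 3 2 (by norm_num)]
  refine tsum_congr fun r => ?_
  have h1 := qFact_ne_zero (norm_sq_lt_one hs) r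
  rw [rogersTermAux, zero_add, mul_inv_cancel₀ h1]
  ring_nf

/-! ### Convergence of the continued fraction -/

lemma rrFraction_get (q : ℂ) (n : ℕ) : (rrFraction q).s.get? n = some ⟨q ^ n, 1⟩ := rfl

lemma rrFraction_dens_succ (q : ℂ) (n : ℕ) : (rrFraction q).dens (n + 2) =
    (rrFraction q).dens (n + 1) + q ^ (n + 1) * (rrFraction q).dens n := by
  rw [GenContFract.dens_recurrence (rrFraction_get q (n + 1)) rfl rfl, one_mul]

lemma rrFraction_nums_succ (q : ℂ) (n : ℕ) : (rrFraction q).nums (n + 2) =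
    (rrFraction q).nums (n + 1) + q ^ (n + 1) * (rrFraction q).nums n := by
  rw [GenContFract.nums_recurrence (rrFraction_get q (n + 1)) rfl rfl, one_mul]

lemma rrFraction_dens_zero (q : ℂ) : (rrFraction q).dens 0 = 1 := GenContFract.zeroth_den_eq_one

lemma rrFraction_nums_zero (q : ℂ) : (rrFraction q).nums 0 = 0 := GenContFract.zeroth_num_eq_h

lemma rrFraction_dens_one (q : ℂ) : (rrFraction q).dens 1 = 1 :=
  GenContFract.first_den_eq (rrFraction_get q 0)

lemma rrFraction_nums_one (q : ℂ) : (rrFraction q).nums 1 = 1 := by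
  rw [GenContFract.first_num_eq (rrFraction_get q 0)]
  simp [rrFraction]

/-- A sequence with the recurrence of the numerators and denominators is bounded. -/
lemma exists_norm_le_of_rec {q : ℂ} (hq : ‖q‖ < 1) {u : ℕ → ℂ} (h0 : ‖u 0‖ ≤ 1) (h1 : ‖u 1‖ ≤ 1)
    (hu : ∀ n, u (n + 2) = u (n + 1) + q ^ (n + 1) * u n) : ∃ M, ∀ n, ‖u n‖ ≤ M := by
  have hstep : ∀ n, ‖u n‖ ≤ ∏ i ∈ Finset.range n, (1 + ‖q‖ ^ i) ∧
      ‖u (n + 1)‖ ≤ ∏ i ∈ Finset.range (n + 1), (1 + ‖q‖ ^ i) := by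
    intro n
    induction n with
    | zero => simpa using ⟨h0, h1.trans (by norm_num)⟩
    | succ n ih =>
      refine ⟨ih.2, ?_⟩
      have h2 : ∏ i ∈ Finset.range n, (1 + ‖q‖ ^ i) ≤
          ∏ i ∈ Finset.range (n + 1), (1 + ‖q‖ ^ i) := by
        rw [Finset.prod_range_succ]
        exact le_mul_of_one_le_right (by positivity) (by simp)
      rw [hu, Finset.prod_range_succ, mul_add, mul_one, mul_comm _ (‖q‖ ^ _)]
      refine (norm_add_le _ _).trans (add_le_add ih.2 ?_)
      rw [norm_mul, norm_pow]
      exact mul_le_mul_of_nonneg_left (ih.1.trans h2) (by positivity)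
  refine ⟨Real.exp (∑' i : ℕ, ‖q‖ ^ i), fun n => (hstep n).1.trans ?_⟩
  calc ∏ i ∈ Finset.range n, (1 + ‖q‖ ^ i) ≤ ∏ i ∈ Finset.range n, Real.exp (‖q‖ ^ i) :=
        Finset.prod_le_prod (fun _ _ => by positivity) fun i _ => by
          rw [add_comm]; exact Real.add_one_le_exp _
    _ = Real.exp (∑ i ∈ Finset.range n, ‖q‖ ^ i) := (Real.exp_sum _ _).symm
    _ ≤ _ := Real.exp_le_exp.2
      ((summable_geometric_of_lt_one (norm_nonneg _) hq).sum_le_tsum _ fun _ _ => by positivity)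

/-- If `F` solves the recurrence dual to that of the numerators and denominators `u`, then
`u n * F n + q ^ n * u (n - 1) * F (n + 1)` does not depend on `n`; as `F` has a nonzero limit, `u`
converges. -/
lemma tendsto_of_rec {q : ℂ} (hq : ‖q‖ < 1) {u F : ℕ → ℂ} {l : ℂ} (h0 : ‖u 0‖ ≤ 1)
    (h1 : ‖u 1‖ ≤ 1) (hu : ∀ n, u (n + 2) = u (n + 1) + q ^ (n + 1) * u n)
    (hF : ∀ n, F n = F (n + 1) + q ^ (n + 1) * F (n + 2)) (hl : l ≠ 0)
    (hlim : Tendsto F atTop (𝓝 l)) :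
    Tendsto u atTop (𝓝 ((u 1 * F 1 + q * u 0 * F 2) / l)) := by
  obtain ⟨M, hM⟩ := exists_norm_le_of_rec hq h0 h1 hu
  have hinv : ∀ n, u (n + 1) * F (n + 1) + q ^ (n + 1) * u n * F (n + 2) =
      u 1 * F 1 + q * u 0 * F 2 := by
    intro n
    induction n with
    | zero => simp
    | succ n ih => rw [← ih, hu, hF (n + 1)]; ring
  have hz : Tendsto (fun n => q ^ (n + 1) * u n * F (n + 2)) atTop (𝓝 0) := by
    have hq' : Tendsto (fun n => q ^ (n + 1)) atTop (𝓝 0) :=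
      (tendsto_add_atTop_iff_nat 1).2 (tendsto_pow_atTop_nhds_zero_of_norm_lt_one hq)
    have h2 : Tendsto (fun n => q ^ (n + 1) * u n) atTop (𝓝 0) :=
      hq'.zero_mul_isBoundedUnder_le (isBoundedUnder_of ⟨M, hM⟩)
    simpa using h2.mul ((tendsto_add_atTop_iff_nat 2).2 hlim)
  have hF' := (tendsto_add_atTop_iff_nat 1).2 hlim
  rw [← tendsto_add_atTop_iff_nat 1]
  have h3 := (tendsto_const_nhds (x := u 1 * F 1 + q * u 0 * F 2)).sub hz
  rw [sub_zero] at h3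
  refine (h3.div hF' hl).congr' ?_
  filter_upwards [hF'.eventually_ne hl] with n hn
  rw [Pi.div_apply, ← hinv n, add_sub_cancel_right, mul_div_cancel_right₀ _ hn]

lemma tendsto_rrFraction {s : ℂ} (hs : ‖s‖ < 1) (h : rogersSeries s 0 ≠ 0) :
    Tendsto (rrFraction (s ^ 2)).convs atTop (𝓝 (rogersSeries s 1 / rogersSeries s 0)) := by
  have hq := norm_sq_lt_one hs
  have hE := qProd_ne_zero_of_norm_lt hq hq
  -- `hB`, `hA`: the limits of the denominators and numerators are `F 0` and `F 1` up to a factor.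
  have hB := tendsto_of_rec hq (u := (rrFraction (s ^ 2)).dens) (by simp)
    (by simp [rrFraction_dens_one]) (rrFraction_dens_succ _) (rogersSeries_rec hs) hE
    (tendsto_rogersSeries hs)
  have hA := tendsto_of_rec hq (u := (rrFraction (s ^ 2)).nums) 
    (by rw [rrFraction_nums_zero, norm_zero]; exact zero_le_one) (by simp [rrFraction_nums_one])
    (rrFraction_nums_succ _) (rogersSeries_rec hs) hE (tendsto_rogersSeries hs)
  have h0 := rogersSeries_rec hs 0
  rw [zero_add, zero_add, pow_one] at h0
  rw [rrFraction_dens_zero, rrFraction_dens_one, one_mul, mul_one, ← h0] at hB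
  rw [rrFraction_nums_zero, rrFraction_nums_one, one_mul, mul_zero, zero_mul, add_zero] at hA
  have := hA.div hB (div_ne_zero h hE)
  rwa [div_div_div_cancel_right₀ hE] at this

/-- The product `(q, q^4; q^5)_∞ / (q^2, q^3; q^5)_∞`. -/
noncomputable def rrProd (q : ℂ) : ℂ :=
  qProd q (q ^ 5) * qProd (q ^ 4) (q ^ 5) / (qProd (q ^ 2) (q ^ 5) * qProd (q ^ 3) (q ^ 5))

lemma qProd_zero (y : ℂ) : qProd 0 y = 1 := by simp [qProd]

lemma norm_pow_lt_one {q : ℂ} (hq : ‖q‖ < 1) {n : ℕ} (hn : n ≠ 0) : ‖q ^ n‖ < 1 := by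
  rw [norm_pow]
  exact pow_lt_one₀ (norm_nonneg _) hq hn

/-- The Rogers-Ramanujan continued fraction converges, and its value is an infinite product. -/
theorem tendsto_rrFraction_rrProd {q : ℂ} (hq : ‖q‖ < 1) :
    Tendsto (rrFraction q).convs atTop (𝓝 (rrProd q)) := by
  obtain ⟨s, rfl⟩ := IsAlgClosed.exists_pow_nat_eq q two_pos
  have hs : ‖s‖ < 1 := by
    rw [norm_pow] at hq
    exact lt_of_pow_lt_pow_left₀ 2 zero_le_one (by simpa using hq)
  have hlim := tendsto_rrFraction hs
  rcases eq_or_ne s 0 with rfl | hs0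
  · have h : ∀ n, rogersSeries 0 n = 1 := by
      intro n
      rw [rogersSeries, tsum_eq_single 0 fun r hr => by simp [rogersTerm, hr]]
      simp [rogersTerm, qFact]
    have := tendsto_rrFraction (s := 0) (by simp) (by simp [h])
    simpa [h, rrProd, qProd_zero] using this
  · have hp : ‖s ^ 5‖ < 1 := norm_pow_lt_one hs (by norm_num)
    have h0 : rogersSeries s 0 = ramTheta (-(s ^ 2) ^ 3) (-(s ^ 2) ^ 2) := by
      rw [rogersSeries_zero hs0 hs]
      exact theta_eq_ramTheta (by simpa using hs0) (pow_ne_zero _ hs0) hp (by ring) (by ring)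
    have h1 : rogersSeries s 1 = ramTheta (-(s ^ 2) ^ 4) (-(s ^ 2)) := by
      rw [rogersSeries_one hs0 hs]
      exact theta_eq_ramTheta (by simpa using hs0) (pow_ne_zero _ hs0) hp (by ring) (by ring)
    generalize s ^ 2 = q at *
    have hq5 : ‖q ^ 5‖ < 1 := norm_pow_lt_one hq (by norm_num)
    have n5 := qProd_ne_zero_of_norm_lt hq5 hq5
    have n3 := qProd_ne_zero_of_norm_lt hq5 (norm_pow_lt_one hq (n := 3) (by norm_num))
    have n2 := qProd_ne_zero_of_norm_lt hq5 (norm_pow_lt_one hq (n := 2) (by norm_num))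
    rw [ramTheta, neg_neg, neg_neg, neg_mul_neg, ← pow_add] at h0
    rw [ramTheta, neg_neg, neg_neg, neg_mul_neg, ← pow_succ] at h1
    have := hlim (by rw [h0]; exact mul_ne_zero (mul_ne_zero n5 n3) n2)
    convert this using 2
    rw [h0, h1, rrProd]
    field_simp

lemma rrValue_eq_rrProd {q : ℂ} (hq : ‖q‖ < 1) : rrValue q = rrProd q :=
  (tendsto_rrFraction_rrProd hq).limUnder_eq

/-! ### Dissections of theta series and of their products -/

lemma eq_sum_of_equiv {α β ι : Type*} [Fintype ι] (e : ι × β ≃ α) {f : α → ℂ} {a : ℂ}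
    (hf : HasSum f a) {g : ι → ℂ} (hg : ∀ i, HasSum (fun b => f (e (i, b))) (g i)) :
    a = ∑ i, g i :=
  ((e.hasSum_iff.2 hf).prod_fiberwise hg).unique (hasSum_fintype g)

/-- The integers, sorted by their residues modulo `5`. -/
def dissectEquiv : Fin 5 × ℤ ≃ ℤ where
  toFun x := 5 * x.2 + ((x.1 : ℤ) - 2)
  invFun n := (⟨((n + 2) % 5).toNat, by lia⟩, (n + 2) / 5)
  left_inv := by
    rintro ⟨⟨r, hr⟩, n⟩
    ext <;> simp <;> lia
  right_inv n := by
    simp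
    lia

/-- `ℤ × ℤ`, sorted by the cosets of the sublattice spanned by `(1, 1)` and `(1, -1)`. -/
def schroeterEquiv : Fin 2 × ℤ × ℤ ≃ ℤ × ℤ where
  toFun x := (x.2.1 + x.2.2 + (x.1 : ℤ), x.2.1 - x.2.2)
  invFun x := (⟨((x.1 - x.2) % 2).toNat, by lia⟩, x.2 + (x.1 - x.2) / 2, (x.1 - x.2) / 2)
  left_inv := by
    rintro ⟨⟨r, hr⟩, u, v⟩
    ext <;> simp <;> lia
  right_inv := by
    rintro ⟨x, y⟩
    ext
    all_goals
      simp
      try lia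

/-- `ℤ × ℤ`, sorted by the cosets of the sublattice spanned by `(2, 1)` and `(-1, 2)`. -/
def squareEquiv : Fin 5 × ℤ × ℤ ≃ ℤ × ℤ where
  toFun x := (2 * x.2.1 - x.2.2 + ((x.1 : ℤ) - 2), x.2.1 + 2 * x.2.2)
  invFun x := (⟨((x.1 - 2 * x.2 + 2) % 5).toNat, by lia⟩,
    x.2 + 2 * ((x.1 - 2 * x.2 + 2) / 5), -((x.1 - 2 * x.2 + 2) / 5))
  left_inv := by
    rintro ⟨⟨r, hr⟩, u, v⟩
    ext <;> simp <;> lia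
  right_inv := by
    rintro ⟨x, y⟩
    ext
    all_goals
      simp
      try lia

/-- `ℤ × ℤ`, sorted by the cosets of the sublattice spanned by `(1, -1)` and `(4, 1)`. -/
def rogersEquiv : Fin 5 × ℤ × ℤ ≃ ℤ × ℤ where
  toFun x := (x.2.1 + 4 * x.2.2 + ((x.1 : ℤ) - 2), x.2.2 - x.2.1)
  invFun x := (⟨((x.1 + x.2 + 2) % 5).toNat, by lia⟩,
    (x.1 + x.2 + 2) / 5 - x.2, (x.1 + x.2 + 2) / 5)
  left_inv := by
    rintro ⟨⟨r, hr⟩, u, v⟩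
    ext <;> simp <;> lia
  right_inv := by
    rintro ⟨x, y⟩
    ext
    all_goals
      simp
      try lia

lemma zpow_eq_of_exponent {p : ℂ} {a b : ℤ} (h : a = b) : p ^ a = p ^ b := by rw [h]

/-- Dissection of a theta series according to the residue modulo `5` of the summation index. -/
theorem theta_dissect {z p : ℂ} (hz : z ≠ 0) (hp0 : p ≠ 0) (hp : ‖p‖ < 1) :
    theta z p = ∑ r : Fin 5, z ^ ((r : ℤ) - 2) * p ^ (((r : ℤ) - 2) ^ 2) *
      theta (z ^ 5 * p ^ (10 * ((r : ℤ) - 2))) (p ^ 25) := by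
  refine eq_sum_of_equiv dissectEquiv (hasSum_theta z hp0 hp) fun r => ?_
  refine ((hasSum_theta _ (pow_ne_zero 25 hp0) (norm_pow_lt_one hp (by norm_num))).mul_left
    _).congr_fun fun n => ?_
  simp only [dissectEquiv, Equiv.coe_fn_mk]
  generalize (r : ℤ) - 2 = c
  simp only [mul_zpow, ← zpow_natCast, ← zpow_mul]
  have h1 : z ^ (5 * n + c) = z ^ c * z ^ (((5 : ℕ) : ℤ) * n) := by
    rw [← zpow_add₀ hz]; exact zpow_eq_of_exponent (by push_cast; ring)
  have h2 : p ^ ((5 * n + c) ^ 2) =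
      p ^ (c ^ 2) * p ^ (10 * c * n) * p ^ (((25 : ℕ) : ℤ) * n ^ 2) := by
    rw [← zpow_add₀ hp0, ← zpow_add₀ hp0]; exact zpow_eq_of_exponent (by push_cast; ring)
  rw [h1, h2]
  ring

/-- **Schröter's formula** for two theta series to the same base. -/
theorem theta_mul_theta_schroeter {z w p : ℂ} (hz : z ≠ 0) (hw : w ≠ 0) (hp0 : p ≠ 0)
    (hp : ‖p‖ < 1) :
    theta z p * theta w p = theta (z * w) (p ^ 2) * theta (z * w⁻¹) (p ^ 2) +
      z * p * (theta (z * w * p ^ 2) (p ^ 2) * theta (z * w⁻¹ * p ^ 2) (p ^ 2)) := by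
  have key : theta z p * theta w p = ∑ r : Fin 2, z ^ (r : ℤ) * p ^ ((r : ℤ) ^ 2) *
      (theta (z * w * p ^ (2 * (r : ℤ))) (p ^ 2) *
        theta (z * w⁻¹ * p ^ (2 * (r : ℤ))) (p ^ 2)) := by
    refine eq_sum_of_equiv schroeterEquiv (hasSum_theta_mul_theta z w hp0 hp hp0 hp) fun r => ?_
    have hp2 : ‖p ^ 2‖ < 1 := norm_pow_lt_one hp (by norm_num)
    refine ((hasSum_theta_mul_theta _ _ (pow_ne_zero 2 hp0) hp2 (pow_ne_zero 2 hp0) hp2).mul_left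
      _).congr_fun fun x => ?_
    obtain ⟨u, v⟩ := x
    simp only [schroeterEquiv, Equiv.coe_fn_mk]
    generalize (r : ℤ) = c
    simp only [mul_zpow, ← zpow_natCast, ← zpow_mul, inv_zpow']
    have h1 : z ^ (u + v + c) = z ^ c * z ^ u * z ^ v := by
      rw [← zpow_add₀ hz, ← zpow_add₀ hz]; exact zpow_eq_of_exponent (by ring)
    have h2 : w ^ (u - v) = w ^ u * w ^ (-v) := by
      rw [← zpow_add₀ hw]; exact zpow_eq_of_exponent (by ring)
    have h3 : p ^ ((u + v + c) ^ 2) * p ^ ((u - v) ^ 2) = p ^ (c ^ 2) * p ^ (2 * c * u) *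
        p ^ (((2 : ℕ) : ℤ) * u ^ 2) * p ^ (2 * c * v) * p ^ (((2 : ℕ) : ℤ) * v ^ 2) := by
      simp only [← zpow_add₀ hp0]; exact zpow_eq_of_exponent (by push_cast; ring)
    rw [h1, h2]
    linear_combination (z ^ c * z ^ u * z ^ v * w ^ u * w ^ (-v)) * h3
  rw [key, Fin.sum_univ_two]
  simp only [Fin.val_zero, Fin.val_one, Nat.cast_zero, Nat.cast_one, mul_zero, mul_one, zpow_zero,
    zpow_one, one_mul, one_pow, ne_eq, OfNat.ofNat_ne_zero, not_false_eq_true, zero_pow]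
  norm_cast

/-- Dissection of `∑ z ^ x w ^ y p ^ (x ^ 2 + y ^ 2)` by the multiples of a Gaussian integer of
norm `5`. -/
theorem theta_mul_theta_square {z w p : ℂ} (hz : z ≠ 0) (hw : w ≠ 0) (hp0 : p ≠ 0)
    (hp : ‖p‖ < 1) :
    theta z p * theta w p = ∑ r : Fin 5, z ^ ((r : ℤ) - 2) * p ^ (((r : ℤ) - 2) ^ 2) *
      (theta (z ^ 2 * w * p ^ (4 * ((r : ℤ) - 2))) (p ^ 5) *
        theta (w ^ 2 * z⁻¹ * p ^ (-2 * ((r : ℤ) - 2))) (p ^ 5)) := by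
  refine eq_sum_of_equiv squareEquiv (hasSum_theta_mul_theta z w hp0 hp hp0 hp) fun r => ?_
  have hp5 : ‖p ^ 5‖ < 1 := norm_pow_lt_one hp (by norm_num)
  refine ((hasSum_theta_mul_theta _ _ (pow_ne_zero 5 hp0) hp5 (pow_ne_zero 5 hp0) hp5).mul_left
    _).congr_fun fun x => ?_
  obtain ⟨u, v⟩ := x
  simp only [squareEquiv, Equiv.coe_fn_mk]
  generalize (r : ℤ) - 2 = c
  simp only [mul_zpow, ← zpow_natCast, ← zpow_mul, inv_zpow']
  have h1 : z ^ (2 * u - v + c) = z ^ c * z ^ (((2 : ℕ) : ℤ) * u) * z ^ (-v) := by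
    rw [← zpow_add₀ hz, ← zpow_add₀ hz]; exact zpow_eq_of_exponent (by push_cast; ring)
  have h2 : w ^ (u + 2 * v) = w ^ u * w ^ (((2 : ℕ) : ℤ) * v) := by
    rw [← zpow_add₀ hw]; exact zpow_eq_of_exponent (by push_cast; ring)
  have h3 : p ^ ((2 * u - v + c) ^ 2) * p ^ ((u + 2 * v) ^ 2) = p ^ (c ^ 2) * p ^ (4 * c * u) *
      p ^ (((5 : ℕ) : ℤ) * u ^ 2) * p ^ (-2 * c * v) * p ^ (((5 : ℕ) : ℤ) * v ^ 2) := by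
    simp only [← zpow_add₀ hp0]; exact zpow_eq_of_exponent (by push_cast; ring)
  rw [h1, h2]
  linear_combination (z ^ c * z ^ (((2 : ℕ) : ℤ) * u) * z ^ (-v) *
    (w ^ u * w ^ (((2 : ℕ) : ℤ) * v))) * h3

/-- Dissection of `∑ z ^ x w ^ y p ^ (x ^ 2 + 4 y ^ 2)` by a sublattice of index `5` on which the
quadratic form is again diagonal. -/
theorem theta_mul_theta_rogers {z w p : ℂ} (hz : z ≠ 0) (hw : w ≠ 0) (hp0 : p ≠ 0)
    (hp : ‖p‖ < 1) :
    theta z p * theta w (p ^ 4) = ∑ r : Fin 5, z ^ ((r : ℤ) - 2) * p ^ (((r : ℤ) - 2) ^ 2) *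
      (theta (z * w⁻¹ * p ^ (2 * ((r : ℤ) - 2))) (p ^ 5) *
        theta (z ^ 4 * w * p ^ (8 * ((r : ℤ) - 2))) (p ^ 20)) := by
  refine eq_sum_of_equiv rogersEquiv (hasSum_theta_mul_theta z w hp0 hp (pow_ne_zero 4 hp0)
    (norm_pow_lt_one hp (by norm_num))) fun r => ?_
  refine ((hasSum_theta_mul_theta _ _ (pow_ne_zero 5 hp0) (norm_pow_lt_one hp (by norm_num))
    (pow_ne_zero 20 hp0) (norm_pow_lt_one hp (by norm_num))).mul_left _).congr_fun fun x => ?_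
  obtain ⟨u, v⟩ := x
  simp only [rogersEquiv, Equiv.coe_fn_mk]
  generalize (r : ℤ) - 2 = c
  simp only [mul_zpow, ← zpow_natCast, ← zpow_mul, inv_zpow']
  have h1 : z ^ (u + 4 * v + c) = z ^ c * z ^ u * z ^ (((4 : ℕ) : ℤ) * v) := by
    rw [← zpow_add₀ hz, ← zpow_add₀ hz]; exact zpow_eq_of_exponent (by push_cast; ring)
  have h2 : w ^ (v - u) = w ^ (-u) * w ^ v := by
    rw [← zpow_add₀ hw]; exact zpow_eq_of_exponent (by ring)
  have h3 : p ^ ((u + 4 * v + c) ^ 2) * p ^ (((4 : ℕ) : ℤ) * (v - u) ^ 2) =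
      p ^ (c ^ 2) * p ^ (2 * c * u) * p ^ (((5 : ℕ) : ℤ) * u ^ 2) * p ^ (8 * c * v) *
        p ^ (((20 : ℕ) : ℤ) * v ^ 2) := by
    simp only [← zpow_add₀ hp0]; exact zpow_eq_of_exponent (by push_cast; ring)
  rw [h1, h2]
  linear_combination (z ^ c * z ^ u * z ^ (((4 : ℕ) : ℤ) * v) * (w ^ (-u) * w ^ v)) * h3

/-! ### Identities between Ramanujan's theta functions -/

/-- Ramanujan's `φ(q) = f(q, q) = ∑_{n ∈ ℤ} q ^ (n ^ 2)`. -/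
noncomputable def phi (q : ℂ) : ℂ := ramTheta q q

/-- Ramanujan's `ψ(q) = ∑_{n ≥ 0} q ^ (n (n + 1) / 2)`, as the product
`(q; q)_∞ (-q; q)_∞ ^ 2`. -/
noncomputable def psi (q : ℂ) : ℂ := qProd q q * qProd (-q) q ^ 2

lemma qProd_eq_one_sub_mul (x : ℂ) {y : ℂ} (hy : ‖y‖ < 1) :
    qProd x y = (1 - x) * qProd (x * y) y := by
  have h := (multipliable_qProd (x * y) hy)
  rw [qProd, tprod_eq_zero_mul' (f := fun n : ℕ => 1 - x * y ^ n) (h.congr fun n => by ring), qProd,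
    pow_zero, mul_one]
  congr 1
  exact tprod_congr fun n => by ring

lemma theta_self {s : ℂ} (hs0 : s ≠ 0) (hs : ‖s‖ < 1) : theta s s = 2 * psi (s ^ 2) := by
  rw [theta_eq_ramTheta (a := s ^ 2) (b := 1) hs0 hs0 hs (by ring) (by ring), ramTheta, mul_one,
    qProd_eq_one_sub_mul (-1) (norm_sq_lt_one hs), psi]
  ring_nf

lemma theta_one {q : ℂ} (hq0 : q ≠ 0) (hq : ‖q‖ < 1) : theta 1 q = phi q :=
  theta_eq_ramTheta one_ne_zero hq0 hq (one_mul q) (mul_one q).symm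

/-- The theta function vanishes as its terms cancel in pairs. -/
lemma ramTheta_neg_one (a : ℂ) : ramTheta a (-1) = 0 := by
  have h : qProd 1 (a * -1) = 0 := by
    have : HasProd (fun n : ℕ => 1 - 1 * (a * -1) ^ n) 0 :=
      hasProd_zero_of_exists_eq_zero ⟨0, by simp⟩
    exact this.tprod_eq
  rw [ramTheta, neg_neg, h, mul_zero]

lemma exists_sq_eq_of_norm_lt_one {q : ℂ} (hq0 : q ≠ 0) (hq : ‖q‖ < 1) :
    ∃ s : ℂ, s ≠ 0 ∧ ‖s‖ < 1 ∧ s ^ 2 = q := by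
  obtain ⟨s, rfl⟩ := IsAlgClosed.exists_pow_nat_eq q two_pos
  refine ⟨s, fun h => hq0 (by simp [h]), ?_, rfl⟩
  rw [norm_pow] at hq
  exact lt_of_pow_lt_pow_left₀ 2 zero_le_one (by simpa using hq)

/-- **Schröter's formula** in Ramanujan's notation: here `a b = c d`, `e = b / c`, `g = b / d`. -/
theorem ramTheta_mul_ramTheta {a b c d e g : ℂ} (ha : a ≠ 0) (hb : b ≠ 0) (hc : c ≠ 0)
    (hab : ‖a * b‖ < 1) (h : a * b = c * d) (he : b = c * e) (hg : b = d * g) :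
    ramTheta a b * ramTheta c d = ramTheta (a * c) (b * d) * ramTheta (a * d) (b * c) +
      a * (ramTheta e (a * c ^ 2 * d) * ramTheta g (a * c * d ^ 2)) := by
  obtain ⟨p, hp0, hp, hpab⟩ := exists_sq_eq_of_norm_lt_one (mul_ne_zero ha hb) hab
  have hd : d ≠ 0 := by rintro rfl; simp_all
  have hp2 : p ^ 2 ≠ 0 := pow_ne_zero 2 hp0
  have hp2' : ‖p ^ 2‖ < 1 := norm_sq_lt_one hp
  have hz : a / p ≠ 0 := div_ne_zero ha hp0
  have hw : c / p ≠ 0 := div_ne_zero hc hp0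
  have hpcd : p ^ 2 = c * d := hpab.trans h
  have h1 : theta (a / p) p = ramTheta a b := by
    refine theta_eq_ramTheta hz hp0 hp (by field_simp) ?_
    field_simp
    linear_combination hpab
  have h2 : theta (c / p) p = ramTheta c d := by
    refine theta_eq_ramTheta hw hp0 hp (by field_simp) ?_
    field_simp
    linear_combination hpcd
  have h3 : theta (a / p * (c / p)) (p ^ 2) = ramTheta (a * c) (b * d) := by
    refine theta_eq_ramTheta (mul_ne_zero hz hw) hp2 hp2' (by field_simp) ?_
    field_simp
    linear_combination p ^ 2 * hpcd + c * d * hpab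
  have h4 : theta (a / p * (c / p)⁻¹) (p ^ 2) = ramTheta (a * d) (b * c) := by
    refine theta_eq_ramTheta (mul_ne_zero hz (inv_ne_zero hw)) hp2 hp2' ?_ ?_
    · field_simp
      linear_combination hpcd
    · field_simp
      linear_combination hpab
  have h5 : theta (a / p * (c / p) * p ^ 2) (p ^ 2) = ramTheta e (a * c ^ 2 * d) := by
    rw [ramTheta_comm]
    refine theta_eq_ramTheta (mul_ne_zero (mul_ne_zero hz hw) hp2) hp2 hp2' ?_ ?_
    · field_simp
      linear_combination hpcd
    · field_simp
      linear_combination hpab + a * he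
  have h6 : theta (a / p * (c / p)⁻¹ * p ^ 2) (p ^ 2) = ramTheta g (a * c * d ^ 2) := by
    rw [ramTheta_comm]
    refine theta_eq_ramTheta (mul_ne_zero (mul_ne_zero hz (inv_ne_zero hw)) hp2) hp2 hp2' ?_ ?_
    · field_simp
      linear_combination (p ^ 2 + c * d) * hpcd
    · field_simp
      exact mul_left_cancel₀ hd (by linear_combination a * hg - h)
  rw [← h1, ← h2, ← h3, ← h4, ← h5, ← h6, theta_mul_theta_schroeter hz hw hp0 hp,
    div_mul_cancel₀ a hp0]


/-- The `5`-dissection of `φ`. -/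
theorem phi_dissect {q : ℂ} (hq0 : q ≠ 0) (hq : ‖q‖ < 1) :
    phi q = phi (q ^ 25) + 2 * q * ramTheta (q ^ 15) (q ^ 35) +
      2 * q ^ 4 * ramTheta (q ^ 5) (q ^ 45) := by
  have h := theta_dissect one_ne_zero hq0 hq
  rw [Fin.sum_univ_five] at h
  norm_num [theta_inv] at h
  have hp := pow_ne_zero 25 hq0
  have hp' := norm_pow_lt_one hq (n := 25) (by norm_num)
  rw [theta_one hq0 hq, theta_one hp hp',
    theta_eq_ramTheta (a := q ^ 35) (b := q ^ 15) (pow_ne_zero 10 hq0) hp hp' (by ring) (by ring),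
    theta_eq_ramTheta (a := q ^ 45) (b := q ^ 5) (pow_ne_zero 20 hq0) hp hp' (by ring)
      (by ring)] at h
  rw [h, ramTheta_comm (q ^ 15), ramTheta_comm (q ^ 5)]
  ring

/-- The `5`-dissection of `ψ`. -/
theorem psi_dissect {q : ℂ} (hq0 : q ≠ 0) (hq : ‖q‖ < 1) :
    psi q = ramTheta (q ^ 10) (q ^ 15) + q * ramTheta (q ^ 5) (q ^ 20) + q ^ 3 * psi (q ^ 25) := by
  obtain ⟨s, hs0, hs, rfl⟩ := exists_sq_eq_of_norm_lt_one hq0 hq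
  have h := theta_dissect hs0 hs0 hs
  rw [Fin.sum_univ_five] at h
  norm_num at h
  have hp := pow_ne_zero 25 hs0
  have hp' := norm_pow_lt_one hs (n := 25) (by norm_num)
  have e1 : s ^ 5 * (s ^ 20)⁻¹ = (s ^ 15)⁻¹ := by field_simp
  have e2 : s ^ 5 * (s ^ 10)⁻¹ = (s ^ 5)⁻¹ := by field_simp
  have e4 : s ^ 5 * s ^ 10 = s ^ 15 := by ring
  have e5 : s ^ 5 * s ^ 20 = s ^ 25 := by ring
  rw [e1, e2, e4, e5, theta_inv, theta_inv, theta_self hs0 hs, theta_self hp hp',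
    theta_eq_ramTheta (a := (s ^ 2) ^ 15) (b := (s ^ 2) ^ 10) (pow_ne_zero 5 hs0) hp hp' (by ring)
      (by ring),
    theta_eq_ramTheta (a := (s ^ 2) ^ 20) (b := (s ^ 2) ^ 5) (pow_ne_zero 15 hs0) hp hp' (by ring)
      (by ring)] at h
  have e3 : (s ^ 2)⁻¹ * s ^ 4 = s ^ 2 := by field_simp
  rw [e3, inv_mul_cancel₀ hs0] at h
  rw [ramTheta_comm (_ ^ 10), ramTheta_comm (_ ^ 5), ← pow_mul s 2 25, mul_comm 2 25,
    pow_mul s 25 2]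
  linear_combination h / 2

/-- The dissection of `∑ q ^ (x ^ 2 + y ^ 2)` by the multiples of `2 + i`: by symmetry, the four
nonzero cosets contribute the same. -/
theorem phi_sq {q : ℂ} (hq0 : q ≠ 0) (hq : ‖q‖ < 1) :
    phi q ^ 2 = phi (q ^ 5) ^ 2 + 4 * q * (ramTheta q (q ^ 9) * ramTheta (q ^ 3) (q ^ 7)) := by
  have h := theta_mul_theta_square one_ne_zero one_ne_zero hq0 hq
  rw [Fin.sum_univ_five] at h
  norm_num [theta_inv] at h
  have hp := pow_ne_zero 5 hq0
  have hp' := norm_pow_lt_one hq (n := 5) (by norm_num)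
  have h8 : q ^ 3 * theta (q ^ 8) (q ^ 5) = theta (q ^ 2) (q ^ 5) := by
    have := theta_mul_sq (z := (q ^ 2)⁻¹) (inv_ne_zero (pow_ne_zero 2 hq0)) hp
    rw [theta_inv] at this
    rw [← this]
    congr 1
    · field_simp
    · congr 1
      field_simp
  have e2 : theta (q ^ 2) (q ^ 5) = ramTheta (q ^ 3) (q ^ 7) := by
    rw [ramTheta_comm]
    exact theta_eq_ramTheta (pow_ne_zero 2 hq0) hp hp' (by ring) (by ring)
  have e4 : theta (q ^ 4) (q ^ 5) = ramTheta q (q ^ 9) := by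
    rw [ramTheta_comm]
    exact theta_eq_ramTheta (pow_ne_zero 4 hq0) hp hp' (by ring) (by ring)
  rw [theta_one hq0 hq, theta_one hp hp', e2, e4] at h
  rw [e2] at h8
  linear_combination h + 2 * q * ramTheta q (q ^ 9) * h8

/-- The analogue of `phi_sq` for a sum over pairs of odd integers. -/
theorem psi_sq {q : ℂ} (hq0 : q ≠ 0) (hq : ‖q‖ < 1) :
    psi q ^ 2 = q * psi (q ^ 5) ^ 2 + ramTheta q (q ^ 4) * ramTheta (q ^ 2) (q ^ 3) := by
  obtain ⟨s, hs0, hs, rfl⟩ := exists_sq_eq_of_norm_lt_one hq0 hq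
  have h := theta_mul_theta_square hs0 hs0 hs0 hs
  rw [Fin.sum_univ_five] at h
  norm_num at h
  have hp := pow_ne_zero 5 hs0
  have hp' := norm_pow_lt_one hs (n := 5) (by norm_num)
  have a1 : s ^ 2 * s * (s ^ 8)⁻¹ = (s ^ 5)⁻¹ := by field_simp
  have a2 : s ^ 2 * s⁻¹ * s ^ 4 = s ^ 5 := by field_simp
  have a3 : s ^ 2 * s * (s ^ 4)⁻¹ = s⁻¹ := by field_simp
  have a4 : s ^ 2 * s⁻¹ * s ^ 2 = s ^ 3 := by field_simp
  have a5 : s ^ 2 * s = s ^ 3 := by ring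
  have a6 : s ^ 2 * s⁻¹ = s := by field_simp
  have a7 : s * (s ^ 2)⁻¹ = s⁻¹ := by field_simp
  have a8 : s * (s ^ 4)⁻¹ = (s ^ 3)⁻¹ := by field_simp
  have a9 : (s ^ 2)⁻¹ * s ^ 4 = s ^ 2 := by field_simp
  have a10 : s ^ 3 * s ^ 4 = s ^ 7 := by ring
  have a11 : s ^ 3 * s ^ 8 = s ^ 11 := by ring
  rw [a1, a2, a3, a4, a5, a6, a7, a8, a9, a10, a11, theta_inv, theta_inv, theta_inv,
    inv_mul_cancel₀ hs0] at h
  have h7 : s ^ 2 * theta (s ^ 7) (s ^ 5) = theta (s ^ 3) (s ^ 5) := by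
    have := theta_mul_sq (z := (s ^ 3)⁻¹) (inv_ne_zero (pow_ne_zero 3 hs0)) hp
    rw [theta_inv] at this
    rw [← this]
    congr 1
    · field_simp
    · congr 1
      field_simp
  have h11 : s ^ 6 * theta (s ^ 11) (s ^ 5) = theta s (s ^ 5) := by
    rw [← theta_mul_sq hs0 hp]
    congr 1
    · ring
    · congr 1
      ring
  have e1 : theta s (s ^ 5) = ramTheta ((s ^ 2) ^ 2) ((s ^ 2) ^ 3) := by
    rw [ramTheta_comm]
    exact theta_eq_ramTheta hs0 hp hp' (by ring) (by ring)
  have e3 : theta (s ^ 3) (s ^ 5) = ramTheta (s ^ 2) ((s ^ 2) ^ 4) := by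
    rw [ramTheta_comm]
    exact theta_eq_ramTheta (pow_ne_zero 3 hs0) hp hp' (by ring) (by ring)
  rw [theta_self hs0 hs, theta_self hp hp', e1, e3] at h
  rw [e1] at h11
  rw [e3] at h7
  rw [← pow_mul s 2 5, mul_comm 2 5, pow_mul s 5 2]
  linear_combination h / 4 + ramTheta ((s ^ 2) ^ 2) ((s ^ 2) ^ 3) / 4 * h7 +
    ramTheta (s ^ 2) ((s ^ 2) ^ 4) / 4 * h11

/-- The dissection of `∑ (-1) ^ y q ^ (x (x + 1) / 2 + 2 y ^ 2)` along a sublattice of index `5`. It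
is the identity behind `G(q) G(q ^ 4) + q H(q) H(q ^ 4) = φ(q) / (q ^ 2; q ^ 2)_∞` for the
Rogers-Ramanujan functions `G` and `H`. -/
theorem psi_mul_phi {q : ℂ} (hq0 : q ≠ 0) (hq : ‖q‖ < 1) :
    psi q * phi (-q ^ 2) = ramTheta (-q ^ 2) (-q ^ 3) * ramTheta (-q ^ 8) (-q ^ 12) +
      q * (ramTheta (-q) (-q ^ 4) * ramTheta (-q ^ 4) (-q ^ 16)) := by
  obtain ⟨s, hs0, hs, rfl⟩ := exists_sq_eq_of_norm_lt_one hq0 hq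
  have h := theta_mul_theta_rogers hs0 (w := -1) (by norm_num) hs0 hs
  rw [Fin.sum_univ_five] at h
  norm_num at h
  have hp := pow_ne_zero 5 hs0
  have hp' := norm_pow_lt_one hs (n := 5) (by norm_num)
  have hr := pow_ne_zero 20 hs0
  have hr' := norm_pow_lt_one hs (n := 20) (by norm_num)
  have a1 : -(s * (s ^ 4)⁻¹) = (-s ^ 3)⁻¹ := by field_simp
  have a2 : -(s ^ 4 * (s ^ 16)⁻¹) = (-s ^ 12)⁻¹ := by field_simp
  have a3 : -(s * (s ^ 2)⁻¹) = (-s)⁻¹ := by field_simp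
  have a4 : -(s ^ 4 * (s ^ 8)⁻¹) = (-s ^ 4)⁻¹ := by field_simp
  have a5 : s * s ^ 2 = s ^ 3 := by ring
  have a6 : s ^ 4 * s ^ 8 = s ^ 12 := by ring
  have a7 : s * s ^ 4 = s ^ 5 := by ring
  have a9 : (s ^ 2)⁻¹ * s ^ 4 = s ^ 2 := by field_simp
  have e0 : theta (-1) (s ^ 4) = phi (-(s ^ 2) ^ 2) :=
    theta_eq_ramTheta (by norm_num) (pow_ne_zero 4 hs0) (norm_pow_lt_one hs (by norm_num))
      (by ring) (by ring)
  have e1 : theta (-s) (s ^ 5) = ramTheta (-(s ^ 2) ^ 2) (-(s ^ 2) ^ 3) := by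
    rw [ramTheta_comm]
    exact theta_eq_ramTheta (neg_ne_zero.2 hs0) hp hp' (by ring) (by ring)
  have e3 : theta (-s ^ 3) (s ^ 5) = ramTheta (-s ^ 2) (-(s ^ 2) ^ 4) := by
    rw [ramTheta_comm]
    exact theta_eq_ramTheta (neg_ne_zero.2 (pow_ne_zero 3 hs0)) hp hp' (by ring) (by ring)
  have e4 : theta (-s ^ 4) (s ^ 20) = ramTheta (-(s ^ 2) ^ 8) (-(s ^ 2) ^ 12) := by
    rw [ramTheta_comm]
    exact theta_eq_ramTheta (neg_ne_zero.2 (pow_ne_zero 4 hs0)) hr hr' (by ring) (by ring)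
  have e12 : theta (-s ^ 12) (s ^ 20) = ramTheta (-(s ^ 2) ^ 4) (-(s ^ 2) ^ 16) := by
    rw [ramTheta_comm]
    exact theta_eq_ramTheta (neg_ne_zero.2 (pow_ne_zero 12 hs0)) hr hr' (by ring) (by ring)
  -- The coset of `(2, 0)` contributes nothing.
  have e5 : theta (-s ^ 5) (s ^ 5) = 0 := by
    rw [theta_eq_ramTheta (a := -s ^ 10) (b := -1) (neg_ne_zero.2 hp) hp hp' (by ring) (by ring),
      ramTheta_neg_one]
  rw [a1, a2, a3, a4, a5, a6, a7, a9, theta_inv, theta_inv, theta_inv, theta_inv,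
    inv_mul_cancel₀ hs0, e0, e1, e3, e4, e12, e5, theta_self hs0 hs] at h
  linear_combination h / 2

/-! ### Product identities -/

lemma qProd_pow_split {q : ℂ} (hq : ‖q‖ < 1) (i : ℕ) {N M K : ℕ} (h : N * M = K) (hK : K ≠ 0) :
    qProd (q ^ i) (q ^ N) = ∏ n ∈ Finset.range M, qProd (q ^ (i + N * n)) (q ^ K) := by
  have hN : N ≠ 0 := by rintro rfl; simp at h; exact hK h.symm
  have hM : 0 < M := Nat.pos_of_ne_zero (by rintro rfl; simp at h; exact hK h.symm)
  rw [qProd_split (q ^ i) (norm_pow_lt_one hq hN) hM]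
  refine Finset.prod_congr rfl fun n _ => ?_
  rw [← pow_mul, ← pow_mul, ← pow_add, h]

/-- All products at a level dividing `20` are monomials in the nonzero numbers
`X i = (q ^ i; q ^ 20)_∞`, so that identities between them become identities between monomials. -/
lemma exists_prod_atoms {q : ℂ} (hq : ‖q‖ < 1) : ∃ X : ℕ → ℂ, (∀ i, i ≠ 0 → X i ≠ 0) ∧
    (∀ i, qProd (q ^ i) (q ^ 20) = X i) ∧
    (∀ i, qProd (q ^ i) (q ^ 10) = X i * X (i + 10)) ∧
    (∀ i, qProd (q ^ i) (q ^ 5) = X i * X (i + 5) * X (i + 10) * X (i + 15)) ∧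
    (∀ i, qProd (q ^ i) (q ^ 4) = X i * X (i + 4) * X (i + 8) * X (i + 12) * X (i + 16)) ∧
    (∀ i, qProd (q ^ i) (q ^ 2) = X i * X (i + 2) * X (i + 4) * X (i + 6) * X (i + 8) *
      X (i + 10) * X (i + 12) * X (i + 14) * X (i + 16) * X (i + 18)) ∧
    (∀ i, qProd (q ^ i) (q ^ 1) = X i * X (i + 1) * X (i + 2) * X (i + 3) * X (i + 4) *
      X (i + 5) * X (i + 6) * X (i + 7) * X (i + 8) * X (i + 9) *
      X (i + 10) * X (i + 11) * X (i + 12) * X (i + 13) * X (i + 14) *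
      X (i + 15) * X (i + 16) * X (i + 17) * X (i + 18) * X (i + 19)) := by
  refine ⟨fun i => qProd (q ^ i) (q ^ 20), fun i hi => qProd_ne_zero_of_norm_lt
    (norm_pow_lt_one hq (by norm_num)) (norm_pow_lt_one hq hi), fun i => rfl, fun i => ?_,
    fun i => ?_, fun i => ?_, fun i => ?_, fun i => ?_⟩
  · rw [qProd_pow_split hq i (show 10 * 2 = 20 from rfl) (by norm_num)]
    simp [Finset.prod_range_succ]
  · rw [qProd_pow_split hq i (show 5 * 4 = 20 from rfl) (by norm_num)]
    simp [Finset.prod_range_succ]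
  · rw [qProd_pow_split hq i (show 4 * 5 = 20 from rfl) (by norm_num)]
    simp [Finset.prod_range_succ]
  · rw [qProd_pow_split hq i (show 2 * 10 = 20 from rfl) (by norm_num)]
    simp [Finset.prod_range_succ]
  · rw [qProd_pow_split hq i (show 1 * 20 = 20 from rfl) (by norm_num)]
    simp [Finset.prod_range_succ]

lemma qProd_neg_pow {q : ℂ} (hq : ‖q‖ < 1) {i N : ℕ} (hi : i ≠ 0) (hN : N ≠ 0) :
    qProd (-q ^ i) (q ^ N) = qProd (q ^ (i * 2)) (q ^ (N * 2)) / qProd (q ^ i) (q ^ N) := by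
  have hN' := norm_pow_lt_one hq hN
  rw [eq_div_iff (qProd_ne_zero_of_norm_lt hN' (norm_pow_lt_one hq hi)), mul_comm,
    qProd_mul_qProd_neg _ hN', pow_mul, pow_mul]

lemma ramTheta_neg_pow (q : ℂ) (i j : ℕ) : ramTheta (-q ^ i) (-q ^ j) =
    qProd (q ^ (i + j)) (q ^ (i + j)) * qProd (q ^ i) (q ^ (i + j)) *
      qProd (q ^ j) (q ^ (i + j)) := by
  rw [ramTheta, neg_neg, neg_neg, neg_mul_neg, ← pow_add]

lemma ramTheta_pow {q : ℂ} (hq : ‖q‖ < 1) {i j : ℕ} (hi : i ≠ 0) (hj : j ≠ 0) :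
    ramTheta (q ^ i) (q ^ j) = qProd (q ^ (i + j)) (q ^ (i + j)) *
      (qProd (q ^ (i * 2)) (q ^ ((i + j) * 2)) / qProd (q ^ i) (q ^ (i + j))) *
      (qProd (q ^ (j * 2)) (q ^ ((i + j) * 2)) / qProd (q ^ j) (q ^ (i + j))) := by
  rw [ramTheta, ← pow_add, qProd_neg_pow hq hi (by lia), qProd_neg_pow hq hj (by lia)]

lemma phi_pow {q : ℂ} (hq : ‖q‖ < 1) {i : ℕ} (hi : i ≠ 0) :
    phi (q ^ i) = qProd (q ^ (i + i)) (q ^ (i + i)) *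
      (qProd (q ^ (i * 2)) (q ^ ((i + i) * 2)) / qProd (q ^ i) (q ^ (i + i))) *
      (qProd (q ^ (i * 2)) (q ^ ((i + i) * 2)) / qProd (q ^ i) (q ^ (i + i))) :=
  ramTheta_pow hq hi hi

lemma phi_neg_pow (q : ℂ) (i : ℕ) :
    phi (-q ^ i) = qProd (q ^ (i + i)) (q ^ (i + i)) * qProd (q ^ i) (q ^ (i + i)) *
      qProd (q ^ i) (q ^ (i + i)) :=
  ramTheta_neg_pow q i i

lemma psi_pow {q : ℂ} (hq : ‖q‖ < 1) {i : ℕ} (hi : i ≠ 0) :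
    psi (q ^ i) = qProd (q ^ i) (q ^ i) *
      (qProd (q ^ (i * 2)) (q ^ (i * 2)) / qProd (q ^ i) (q ^ i)) ^ 2 := by
  rw [psi, qProd_neg_pow hq hi hi]

lemma rrProd_pow (q : ℂ) (i : ℕ) :
    rrProd (q ^ i) = qProd (q ^ i) (q ^ (i * 5)) * qProd (q ^ (i * 4)) (q ^ (i * 5)) /
      (qProd (q ^ (i * 2)) (q ^ (i * 5)) * qProd (q ^ (i * 3)) (q ^ (i * 5))) := by
  simp only [rrProd, pow_mul]

lemma rrProd_ne_zero {q : ℂ} (hq : ‖q‖ < 1) : rrProd q ≠ 0 := by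
  have h : ∀ i, qProd (q ^ (i + 1)) (q ^ 5) ≠ 0 := fun i =>
    qProd_ne_zero_of_norm_lt (norm_pow_lt_one hq (by norm_num)) (norm_pow_lt_one hq i.succ_ne_zero)
  have h1 := h 0
  rw [zero_add, pow_one] at h1
  exact div_ne_zero (mul_ne_zero h1 (h 3)) (mul_ne_zero (h 1) (h 2))

lemma psi_ne_zero {q : ℂ} (hq : ‖q‖ < 1) : psi q ≠ 0 :=
  mul_ne_zero (qProd_ne_zero_of_norm_lt hq hq)
    (pow_ne_zero 2 (qProd_ne_zero_of_norm_lt hq (by rwa [norm_neg])))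

lemma phi_ne_zero {q : ℂ} (hq : ‖q‖ < 1) : phi q ≠ 0 := by
  have h : ‖q * q‖ < 1 := by rw [← sq]; exact norm_sq_lt_one hq
  have h' := qProd_ne_zero_of_norm_lt h (x := -q) (by rwa [norm_neg])
  exact mul_ne_zero (mul_ne_zero (qProd_ne_zero_of_norm_lt h h) h') h'

lemma ramTheta_neg_pow_ne_zero {q : ℂ} (hq : ‖q‖ < 1) {i j : ℕ} (hi : i ≠ 0) (hj : j ≠ 0) :
    ramTheta (-q ^ i) (-q ^ j) ≠ 0 := by
  have h := norm_pow_lt_one hq (n := i + j) (by lia)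
  rw [ramTheta_neg_pow]
  exact mul_ne_zero (mul_ne_zero (qProd_ne_zero_of_norm_lt h h)
    (qProd_ne_zero_of_norm_lt h (norm_pow_lt_one hq hi)))
    (qProd_ne_zero_of_norm_lt h (norm_pow_lt_one hq hj))

section

-- The same rewriting rules serve all identities below; the exponent in `q ^ 1` lets them apply.
set_option linter.unusedSimpArgs false

lemma rrProd_mul_sq_mul {q : ℂ} (hq : ‖q‖ < 1) :
    rrProd (q ^ 1) * rrProd (q ^ 2) ^ 2 *
        (ramTheta (-q ^ 3) (-q ^ 7) * ramTheta (-q ^ 4) (-q ^ 6)) =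
      ramTheta (-q ^ 1) (-q ^ 9) * ramTheta (-q ^ 2) (-q ^ 8) := by
  obtain ⟨X, hX, e20, e10, e5, e4, e2, e1⟩ := exists_prod_atoms hq
  simp only [rrProd_pow, psi_pow hq, phi_pow hq, phi_neg_pow, ramTheta_pow hq, ramTheta_neg_pow,
    ne_eq, OfNat.ofNat_ne_zero, one_ne_zero, not_false_eq_true]
  norm_num only
  simp only [e20, e10, e5, e4, e2, e1]
  norm_num only
  field_simp [hX]

lemma psi_five_mul {q : ℂ} (hq : ‖q‖ < 1) :
    psi (q ^ 5) * ramTheta (-q ^ 2) (-q ^ 3) =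
      ramTheta (-q ^ 3) (-q ^ 7) * ramTheta (-q ^ 2) (-q ^ 8) := by
  obtain ⟨X, hX, e20, e10, e5, e4, e2, e1⟩ := exists_prod_atoms hq
  simp only [rrProd_pow, psi_pow hq, phi_pow hq, phi_neg_pow, ramTheta_pow hq, ramTheta_neg_pow,
    ne_eq, OfNat.ofNat_ne_zero, one_ne_zero, not_false_eq_true]
  norm_num only
  simp only [e20, e10, e5, e4, e2, e1]
  norm_num only
  field_simp [hX]

lemma rrProd_mul_ramTheta {q : ℂ} (hq : ‖q‖ < 1) :
    rrProd (q ^ 1) * ramTheta (-q ^ 2) (-q ^ 3) =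
      ramTheta (-q ^ 1) (-q ^ 4) := by
  obtain ⟨X, hX, e20, e10, e5, e4, e2, e1⟩ := exists_prod_atoms hq
  simp only [rrProd_pow, psi_pow hq, phi_pow hq, phi_neg_pow, ramTheta_pow hq, ramTheta_neg_pow,
    ne_eq, OfNat.ofNat_ne_zero, one_ne_zero, not_false_eq_true]
  norm_num only
  simp only [e20, e10, e5, e4, e2, e1]
  norm_num only
  field_simp [hX]

lemma rrProd_two_mul_ramTheta {q : ℂ} (hq : ‖q‖ < 1) :
    rrProd (q ^ 2) * ramTheta (-q ^ 4) (-q ^ 6) =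
      ramTheta (-q ^ 2) (-q ^ 8) := by
  obtain ⟨X, hX, e20, e10, e5, e4, e2, e1⟩ := exists_prod_atoms hq
  simp only [rrProd_pow, psi_pow hq, phi_pow hq, phi_neg_pow, ramTheta_pow hq, ramTheta_neg_pow,
    ne_eq, OfNat.ofNat_ne_zero, one_ne_zero, not_false_eq_true]
  norm_num only
  simp only [e20, e10, e5, e4, e2, e1]
  norm_num only
  field_simp [hX]

lemma rrProd_four_mul_ramTheta {q : ℂ} (hq : ‖q‖ < 1) :
    rrProd (q ^ 4) * ramTheta (-q ^ 8) (-q ^ 12) =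
      ramTheta (-q ^ 4) (-q ^ 16) := by
  obtain ⟨X, hX, e20, e10, e5, e4, e2, e1⟩ := exists_prod_atoms hq
  simp only [rrProd_pow, psi_pow hq, phi_pow hq, phi_neg_pow, ramTheta_pow hq, ramTheta_neg_pow,
    ne_eq, OfNat.ofNat_ne_zero, one_ne_zero, not_false_eq_true]
  norm_num only
  simp only [e20, e10, e5, e4, e2, e1]
  field_simp [hX]

lemma rrProd_quotient_mul {q : ℂ} (hq : ‖q‖ < 1) :
    rrProd (q ^ 1) ^ 2 * rrProd (q ^ 2) * (ramTheta (q ^ 1) (q ^ 9) * ramTheta (-q ^ 3) (-q ^ 7)) =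
      rrProd (q ^ 4) * (ramTheta (-q ^ 1) (-q ^ 9) * ramTheta (q ^ 3) (q ^ 7)) := by
  obtain ⟨X, hX, e20, e10, e5, e4, e2, e1⟩ := exists_prod_atoms hq
  simp only [rrProd_pow, psi_pow hq, phi_pow hq, phi_neg_pow, ramTheta_pow hq, ramTheta_neg_pow,
    ne_eq, OfNat.ofNat_ne_zero, one_ne_zero, not_false_eq_true]
  norm_num only
  simp only [e20, e10, e5, e4, e2, e1]
  norm_num only
  field_simp [hX]

lemma psi_two_mul_ramTheta_four_six {q : ℂ} (hq : ‖q‖ < 1) :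
    psi (q ^ 2) * (ramTheta (-q ^ 1) (-q ^ 9) * ramTheta (q ^ 3) (q ^ 7)) =
      rrProd (q ^ 1) * ramTheta (q ^ 4) (q ^ 6) *
        (ramTheta (-q ^ 4) (-q ^ 16) * ramTheta (-q ^ 8) (-q ^ 12)) := by
  obtain ⟨X, hX, e20, e10, e5, e4, e2, e1⟩ := exists_prod_atoms hq
  simp only [rrProd_pow, psi_pow hq, phi_pow hq, phi_neg_pow, ramTheta_pow hq, ramTheta_neg_pow,
    ne_eq, OfNat.ofNat_ne_zero, one_ne_zero, not_false_eq_true]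
  norm_num only
  simp only [e20, e10, e5, e4, e2, e1]
  norm_num only
  field_simp [hX]

lemma psi_two_mul_ramTheta_two_eight {q : ℂ} (hq : ‖q‖ < 1) :
    rrProd (q ^ 1) * psi (q ^ 2) * (ramTheta (q ^ 1) (q ^ 9) * ramTheta (-q ^ 3) (-q ^ 7)) =
      ramTheta (q ^ 2) (q ^ 8) * (ramTheta (-q ^ 4) (-q ^ 16) * ramTheta (-q ^ 8) (-q ^ 12)) := by
  obtain ⟨X, hX, e20, e10, e5, e4, e2, e1⟩ := exists_prod_atoms hq
  simp only [rrProd_pow, psi_pow hq, phi_pow hq, phi_neg_pow, ramTheta_pow hq, ramTheta_neg_pow,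
    ne_eq, OfNat.ofNat_ne_zero, one_ne_zero, not_false_eq_true]
  norm_num only
  simp only [e20, e10, e5, e4, e2, e1]
  norm_num only
  field_simp [hX]

lemma psi_two_mul_eq_psi_ten_mul {q : ℂ} (hq : ‖q‖ < 1) :
    psi (q ^ 2) * (ramTheta (-q ^ 6) (-q ^ 14) * ramTheta (-q ^ 2) (-q ^ 18)) =
      psi (q ^ 10) * (ramTheta (-q ^ 4) (-q ^ 16) * ramTheta (-q ^ 8) (-q ^ 12)) := by
  obtain ⟨X, hX, e20, e10, e5, e4, e2, e1⟩ := exists_prod_atoms hq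
  simp only [rrProd_pow, psi_pow hq, phi_pow hq, phi_neg_pow, ramTheta_pow hq, ramTheta_neg_pow,
    ne_eq, OfNat.ofNat_ne_zero, one_ne_zero, not_false_eq_true]
  norm_num only
  simp only [e20, e10, e5, e4, e2, e1]
  norm_num only
  field_simp [hX]

lemma ramTheta_one_nine_mul {q : ℂ} (hq : ‖q‖ < 1) :
    ramTheta (q ^ 1) (q ^ 9) * (psi (q ^ 1) * phi (-q ^ 2)) =
      rrProd (q ^ 4) * phi (q ^ 1) *
        (ramTheta (-q ^ 2) (-q ^ 3) * ramTheta (-q ^ 8) (-q ^ 12)) := by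
  obtain ⟨X, hX, e20, e10, e5, e4, e2, e1⟩ := exists_prod_atoms hq
  simp only [rrProd_pow, psi_pow hq, phi_pow hq, phi_neg_pow, ramTheta_pow hq, ramTheta_neg_pow,
    ne_eq, OfNat.ofNat_ne_zero, one_ne_zero, not_false_eq_true]
  norm_num only
  simp only [e20, e10, e5, e4, e2, e1]
  norm_num only
  field_simp [hX]

lemma ramTheta_three_seven_mul {q : ℂ} (hq : ‖q‖ < 1) :
    ramTheta (q ^ 3) (q ^ 7) * (psi (q ^ 1) * phi (-q ^ 2)) =
      rrProd (q ^ 1) * phi (q ^ 1) *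
        (ramTheta (-q ^ 2) (-q ^ 3) * ramTheta (-q ^ 8) (-q ^ 12)) := by
  obtain ⟨X, hX, e20, e10, e5, e4, e2, e1⟩ := exists_prod_atoms hq
  simp only [rrProd_pow, psi_pow hq, phi_pow hq, phi_neg_pow, ramTheta_pow hq, ramTheta_neg_pow,
    ne_eq, OfNat.ofNat_ne_zero, one_ne_zero, not_false_eq_true]
  norm_num only
  simp only [e20, e10, e5, e4, e2, e1]
  norm_num only
  field_simp [hX]

end

/-! ### Instances of Schröter's formula -/

/-- `ramTheta_mul_ramTheta` with all arguments as variables, for use with monomials. -/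
lemma ramTheta_mul_ramTheta_of_eq {a b c d a₁ b₁ a₂ b₂ a₃ b₃ a₄ b₄ : ℂ} (hab0 : a * b ≠ 0)
    (hab : ‖a * b‖ < 1) (h : a * b = c * d) (h₁ : a * c = a₁) (h₁' : b * d = b₁) (h₂ : a * d = a₂)
    (h₂' : b * c = b₂) (h₃ : c * a₃ = b) (h₃' : a * c ^ 2 * d = b₃) (h₄ : d * a₄ = b)
    (h₄' : a * c * d ^ 2 = b₄) :
    ramTheta a b * ramTheta c d = ramTheta a₁ b₁ * ramTheta a₂ b₂ +
      a * (ramTheta a₃ b₃ * ramTheta a₄ b₄) := by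
  subst h₁ h₁' h₂ h₂' h₃' h₄'
  exact ramTheta_mul_ramTheta (left_ne_zero_of_mul hab0) (right_ne_zero_of_mul hab0)
    (left_ne_zero_of_mul (h ▸ hab0)) hab h h₃.symm h₄.symm

section

variable {q : ℂ}

lemma schroeter_five (hq0 : q ≠ 0) (hq : ‖q‖ < 1) :
    ramTheta q (q ^ 4) * ramTheta (-q ^ 2) (-q ^ 3) =
      ramTheta (-q ^ 3) (-q ^ 7) * ramTheta (-q ^ 4) (-q ^ 6) +
        q * (ramTheta (-q) (-q ^ 9) * ramTheta (-q ^ 2) (-q ^ 8)) := by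
  rw [mul_comm (ramTheta (-q) _)]
  refine ramTheta_mul_ramTheta_of_eq ?_ ?_ ?_ ?_ ?_ ?_ ?_ ?_ ?_ ?_ ?_
  · simpa
  · rw [← pow_succ']; exact norm_pow_lt_one hq (by norm_num)
  all_goals ring

lemma schroeter_five_neg (hq0 : q ≠ 0) (hq : ‖q‖ < 1) :
    ramTheta (-q) (-q ^ 4) * ramTheta (q ^ 2) (q ^ 3) =
      ramTheta (-q ^ 3) (-q ^ 7) * ramTheta (-q ^ 4) (-q ^ 6) -
        q * (ramTheta (-q) (-q ^ 9) * ramTheta (-q ^ 2) (-q ^ 8)) := by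
  rw [mul_comm (ramTheta (-q) (-q ^ 9)), sub_eq_add_neg, ← neg_mul]
  refine ramTheta_mul_ramTheta_of_eq ?_ ?_ ?_ ?_ ?_ ?_ ?_ ?_ ?_ ?_ ?_
  · simpa
  · rw [neg_mul_neg, ← pow_succ']; exact norm_pow_lt_one hq (by norm_num)
  all_goals ring

lemma schroeter_ten (hq0 : q ≠ 0) (hq : ‖q‖ < 1) :
    ramTheta q (q ^ 9) * ramTheta (-q ^ 3) (-q ^ 7) =
      ramTheta (-q ^ 4) (-q ^ 16) * ramTheta (-q ^ 8) (-q ^ 12) +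
        q * (ramTheta (-q ^ 6) (-q ^ 14) * ramTheta (-q ^ 2) (-q ^ 18)) := by
  refine ramTheta_mul_ramTheta_of_eq ?_ ?_ ?_ ?_ ?_ ?_ ?_ ?_ ?_ ?_ ?_
  · simpa
  · rw [← pow_succ']; exact norm_pow_lt_one hq (by norm_num)
  all_goals ring

lemma schroeter_ten_neg (hq0 : q ≠ 0) (hq : ‖q‖ < 1) :
    ramTheta (-q) (-q ^ 9) * ramTheta (q ^ 3) (q ^ 7) =
      ramTheta (-q ^ 4) (-q ^ 16) * ramTheta (-q ^ 8) (-q ^ 12) -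
        q * (ramTheta (-q ^ 6) (-q ^ 14) * ramTheta (-q ^ 2) (-q ^ 18)) := by
  rw [sub_eq_add_neg, ← neg_mul]
  refine ramTheta_mul_ramTheta_of_eq ?_ ?_ ?_ ?_ ?_ ?_ ?_ ?_ ?_ ?_ ?_
  · simpa
  · rw [neg_mul_neg, ← pow_succ']; exact norm_pow_lt_one hq (by norm_num)
  all_goals ring

end

/-! ### The parameter `R(q) R(q ^ 2) ^ 2` -/

/-- The parameter `k = R(q) R(q ^ 2) ^ 2`. -/
noncomputable def paramK (q : ℂ) : ℂ := q * rrProd q * rrProd (q ^ 2) ^ 2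

section

variable {q : ℂ}

lemma paramK_mul (hq : ‖q‖ < 1) :
    paramK q * (ramTheta (-q ^ 3) (-q ^ 7) * ramTheta (-q ^ 4) (-q ^ 6)) =
      q * (ramTheta (-q) (-q ^ 9) * ramTheta (-q ^ 2) (-q ^ 8)) := by
  have h := rrProd_mul_sq_mul hq
  rw [pow_one] at h
  rw [← h, paramK]
  ring

/-- Schröter's formula gives `1 + k` as a product. -/
lemma ramTheta_one_four_mul (hq0 : q ≠ 0) (hq : ‖q‖ < 1) :
    ramTheta q (q ^ 4) * rrProd (q ^ 2) = (1 + paramK q) * psi (q ^ 5) := by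
  have n23 := ramTheta_neg_pow_ne_zero hq (i := 2) (j := 3) (by norm_num) (by norm_num)
  refine mul_right_cancel₀ n23 ?_
  linear_combination rrProd (q ^ 2) * schroeter_five hq0 hq - rrProd (q ^ 2) * paramK_mul hq +
    (1 + paramK q) * ramTheta (-q ^ 3) (-q ^ 7) * rrProd_two_mul_ramTheta hq -
    (1 + paramK q) * psi_five_mul hq

/-- Schröter's formula gives `1 - k` as a product. -/
lemma ramTheta_two_three_mul (hq0 : q ≠ 0) (hq : ‖q‖ < 1) :
    ramTheta (q ^ 2) (q ^ 3) * (rrProd q * rrProd (q ^ 2)) = (1 - paramK q) * psi (q ^ 5) := by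
  have n23 := ramTheta_neg_pow_ne_zero hq (i := 2) (j := 3) (by norm_num) (by norm_num)
  have h := rrProd_mul_ramTheta hq
  rw [pow_one] at h
  refine mul_right_cancel₀ n23 ?_
  linear_combination ramTheta (q ^ 2) (q ^ 3) * rrProd (q ^ 2) * h +
    rrProd (q ^ 2) * schroeter_five_neg hq0 hq + rrProd (q ^ 2) * paramK_mul hq +
    (1 - paramK q) * ramTheta (-q ^ 3) (-q ^ 7) * rrProd_two_mul_ramTheta hq -
    (1 - paramK q) * psi_five_mul hq

/-- In the form `ψ(q) ^ 2 / (q ψ(q ^ 5) ^ 2) = 1 / k + 1 - k`. -/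
lemma psi_sq_mul_paramK (hq0 : q ≠ 0) (hq : ‖q‖ < 1) :
    psi q ^ 2 * paramK q = q * psi (q ^ 5) ^ 2 * (1 + paramK q - paramK q ^ 2) := by
  rw [psi_sq hq0 hq]
  have h1 := ramTheta_one_four_mul hq0 hq
  have h2 := ramTheta_two_three_mul hq0 hq
  have hk : paramK q = q * rrProd q * rrProd (q ^ 2) ^ 2 := rfl
  linear_combination ramTheta q (q ^ 4) * ramTheta (q ^ 2) (q ^ 3) * hk +
    q * ramTheta (q ^ 2) (q ^ 3) * rrProd q * rrProd (q ^ 2) * h1 +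
    q * (1 + paramK q) * psi (q ^ 5) * h2

end

/-! ### The parameter `R(q) ^ 2 R(q ^ 2) / R(q ^ 4)` -/

/-- The parameter `m = R(q) ^ 2 R(q ^ 2) / R(q ^ 4)`. -/
noncomputable def paramM (q : ℂ) : ℂ := rrProd q ^ 2 * rrProd (q ^ 2) / rrProd (q ^ 4)

section

variable {q : ℂ}

lemma paramM_mul (hq : ‖q‖ < 1) :
    paramM q * (ramTheta q (q ^ 9) * ramTheta (-q ^ 3) (-q ^ 7)) =
      ramTheta (-q) (-q ^ 9) * ramTheta (q ^ 3) (q ^ 7) := by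
  have h := rrProd_quotient_mul hq
  have h4 := rrProd_ne_zero (norm_pow_lt_one hq (n := 4) (by norm_num))
  simp only [pow_one] at h
  rw [paramM, div_mul_eq_mul_div, h, mul_div_cancel_left₀ _ h4]

lemma one_add_paramM_mul (hq0 : q ≠ 0) (hq : ‖q‖ < 1) :
    (1 + paramM q) * (ramTheta q (q ^ 9) * ramTheta (-q ^ 3) (-q ^ 7)) =
      2 * (ramTheta (-q ^ 4) (-q ^ 16) * ramTheta (-q ^ 8) (-q ^ 12)) := by
  linear_combination paramM_mul hq + schroeter_ten hq0 hq + schroeter_ten_neg hq0 hq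

lemma one_sub_paramM_mul (hq0 : q ≠ 0) (hq : ‖q‖ < 1) :
    (1 - paramM q) * (ramTheta q (q ^ 9) * ramTheta (-q ^ 3) (-q ^ 7)) =
      2 * q * (ramTheta (-q ^ 6) (-q ^ 14) * ramTheta (-q ^ 2) (-q ^ 18)) := by
  linear_combination -paramM_mul hq + schroeter_ten hq0 hq - schroeter_ten_neg hq0 hq

lemma one_add_paramM_ne_zero (hq0 : q ≠ 0) (hq : ‖q‖ < 1) : 1 + paramM q ≠ 0 := by
  refine left_ne_zero_of_mul (b := ramTheta q (q ^ 9) * ramTheta (-q ^ 3) (-q ^ 7)) ?_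
  rw [one_add_paramM_mul hq0 hq]
  exact mul_ne_zero two_ne_zero (mul_ne_zero
    (ramTheta_neg_pow_ne_zero hq (by norm_num) (by norm_num))
    (ramTheta_neg_pow_ne_zero hq (by norm_num) (by norm_num)))

lemma ramTheta_one_nine_mul_ne_zero (hq0 : q ≠ 0) (hq : ‖q‖ < 1) :
    ramTheta q (q ^ 9) * ramTheta (-q ^ 3) (-q ^ 7) ≠ 0 := by
  refine right_ne_zero_of_mul (a := 1 + paramM q) ?_
  rw [one_add_paramM_mul hq0 hq]
  exact mul_ne_zero two_ne_zero (mul_ne_zero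
    (ramTheta_neg_pow_ne_zero hq (by norm_num) (by norm_num))
    (ramTheta_neg_pow_ne_zero hq (by norm_num) (by norm_num)))

/-- In the form `(1 - m) / (1 + m) = q ψ(q ^ 10) / ψ(q ^ 2)`. -/
lemma psi_ten_mul (hq0 : q ≠ 0) (hq : ‖q‖ < 1) :
    q * psi (q ^ 10) * (1 + paramM q) = psi (q ^ 2) * (1 - paramM q) := by
  refine mul_right_cancel₀ (ramTheta_one_nine_mul_ne_zero hq0 hq) ?_
  linear_combination q * psi (q ^ 10) * one_add_paramM_mul hq0 hq -
    psi (q ^ 2) * one_sub_paramM_mul hq0 hq - 2 * q * psi_two_mul_eq_psi_ten_mul hq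

lemma ramTheta_four_six_mul (hq0 : q ≠ 0) (hq : ‖q‖ < 1) :
    ramTheta (q ^ 4) (q ^ 6) * (1 + paramM q) * rrProd q = 2 * paramM q * psi (q ^ 2) := by
  have h := psi_two_mul_ramTheta_four_six hq
  simp only [pow_one] at h
  refine mul_right_cancel₀ (ramTheta_one_nine_mul_ne_zero hq0 hq) ?_
  linear_combination ramTheta (q ^ 4) (q ^ 6) * rrProd q * one_add_paramM_mul hq0 hq - 2 * h -
    2 * psi (q ^ 2) * paramM_mul hq

lemma ramTheta_two_eight_mul (hq0 : q ≠ 0) (hq : ‖q‖ < 1) :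
    ramTheta (q ^ 2) (q ^ 8) * (1 + paramM q) = 2 * rrProd q * psi (q ^ 2) := by
  have h := psi_two_mul_ramTheta_two_eight hq
  simp only [pow_one] at h
  refine mul_right_cancel₀ (ramTheta_one_nine_mul_ne_zero hq0 hq) ?_
  linear_combination ramTheta (q ^ 2) (q ^ 8) * one_add_paramM_mul hq0 hq - 2 * h

end

/-! ### The parameter `R(q) R(q ^ 4)` -/

/-- The parameter `w = R(q) R(q ^ 4)`. -/
noncomputable def paramW (q : ℂ) : ℂ := q * rrProd q * rrProd (q ^ 4)

section

variable {q : ℂ}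

lemma one_add_paramW_mul (hq0 : q ≠ 0) (hq : ‖q‖ < 1) :
    (1 + paramW q) * (ramTheta (-q ^ 2) (-q ^ 3) * ramTheta (-q ^ 8) (-q ^ 12)) =
      psi q * phi (-q ^ 2) := by
  have h1 := rrProd_mul_ramTheta hq
  have h2 := rrProd_four_mul_ramTheta hq
  simp only [pow_one] at h1
  rw [psi_mul_phi hq0 hq, ← h1, ← h2, paramW]
  ring

lemma one_add_paramW_ne_zero (hq : ‖q‖ < 1) : 1 + paramW q ≠ 0 := by
  rcases eq_or_ne q 0 with rfl | hq0
  · simp [paramW]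
  · refine left_ne_zero_of_mul
      (b := ramTheta (-q ^ 2) (-q ^ 3) * ramTheta (-q ^ 8) (-q ^ 12)) ?_
    rw [one_add_paramW_mul hq0 hq]
    refine mul_ne_zero (psi_ne_zero hq) (phi_ne_zero ?_)
    rw [norm_neg]
    exact norm_sq_lt_one hq

/-- In the form `f(q ^ 3, q ^ 7) / φ(q) = q ^ (-1 / 5) R(q) / (1 + w)`. -/
lemma ramTheta_three_seven_eq (hq0 : q ≠ 0) (hq : ‖q‖ < 1) :
    ramTheta (q ^ 3) (q ^ 7) * (1 + paramW q) = rrProd q * phi q := by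
  have h := ramTheta_three_seven_mul hq
  simp only [pow_one] at h
  refine mul_right_cancel₀ (mul_ne_zero
    (ramTheta_neg_pow_ne_zero hq (i := 2) (j := 3) (by norm_num) (by norm_num))
    (ramTheta_neg_pow_ne_zero hq (i := 8) (j := 12) (by norm_num) (by norm_num))) ?_
  linear_combination ramTheta (q ^ 3) (q ^ 7) * one_add_paramW_mul hq0 hq + h

/-- In the form `f(q, q ^ 9) / φ(q) = q ^ (-4 / 5) R(q ^ 4) / (1 + w)`. -/
lemma ramTheta_one_nine_eq (hq0 : q ≠ 0) (hq : ‖q‖ < 1) :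
    ramTheta q (q ^ 9) * (1 + paramW q) = rrProd (q ^ 4) * phi q := by
  have h := ramTheta_one_nine_mul hq
  simp only [pow_one] at h
  refine mul_right_cancel₀ (mul_ne_zero
    (ramTheta_neg_pow_ne_zero hq (i := 2) (j := 3) (by norm_num) (by norm_num))
    (ramTheta_neg_pow_ne_zero hq (i := 8) (j := 12) (by norm_num) (by norm_num))) ?_
  linear_combination ramTheta q (q ^ 9) * one_add_paramW_mul hq0 hq + h

lemma phi_zero : phi 0 = 1 := by simp [phi, ramTheta, qProd_zero]

lemma phi_five_sq_mul (hq : ‖q‖ < 1) :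
    (phi q * (1 - paramW q)) ^ 2 = (phi (q ^ 5) * (1 + paramW q)) ^ 2 := by
  rcases eq_or_ne q 0 with rfl | hq0
  · simp [paramW, phi_zero]
  · have h1 := ramTheta_three_seven_eq hq0 hq
    have h2 := ramTheta_one_nine_eq hq0 hq
    have hw : paramW q = q * rrProd q * rrProd (q ^ 4) := rfl
    linear_combination (1 + paramW q) ^ 2 * phi_sq hq0 hq - 4 * phi q ^ 2 * hw +
      4 * q * ramTheta q (q ^ 9) * (1 + paramW q) * h1 + 4 * q * rrProd q * phi q * h2

lemma continuousOn_phi : ContinuousOn phi (Metric.ball 0 1) := by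
  have h1 := continuousOn_qProd 1 2 two_pos
  have h2 := continuousOn_qProd (-1) 1 two_pos
  simp only [one_mul, pow_one, neg_mul] at h1 h2
  refine ((h1.mul h2).mul h2).congr fun q _ => ?_
  simp only [phi, ramTheta, sq]
  rfl

lemma continuousOn_rrProd : ContinuousOn rrProd (Metric.ball 0 1) := by
  have h : ∀ i : ℕ, ContinuousOn (fun q : ℂ => qProd (q ^ i) (q ^ 5)) (Metric.ball 0 1) := by
    intro i
    simpa only [one_mul] using continuousOn_qProd 1 i (N := 5) (by norm_num)
  have h1 := h 1
  simp only [pow_one] at h1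
  refine (h1.mul (h 4)).div ((h 2).mul (h 3)) fun q hq => ?_
  rw [mem_ball_zero_iff] at hq
  exact mul_ne_zero
    (qProd_ne_zero_of_norm_lt (norm_pow_lt_one hq (by norm_num)) (norm_pow_lt_one hq (by norm_num)))
    (qProd_ne_zero_of_norm_lt (norm_pow_lt_one hq (by norm_num)) (norm_pow_lt_one hq (by norm_num)))

lemma ContinuousOn.comp_pow {f : ℂ → ℂ} (hf : ContinuousOn f (Metric.ball 0 1)) {n : ℕ}
    (hn : n ≠ 0) : ContinuousOn (fun q => f (q ^ n)) (Metric.ball 0 1) :=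
  hf.comp (by fun_prop) fun q hq => by
    rw [mem_ball_zero_iff] at hq ⊢
    exact norm_pow_lt_one hq hn

lemma continuousOn_paramW : ContinuousOn paramW (Metric.ball 0 1) :=
  (continuousOn_id.mul continuousOn_rrProd).mul
    (ContinuousOn.comp_pow continuousOn_rrProd (by norm_num))

/-- The identity `φ(q ^ 5) / φ(q) = (1 - w) / (1 + w)`. The theta identities at hand give its
square; as both sides are continuous and nonzero on the disc, the sign is the one at `q = 0`. -/
theorem phi_five_mul (hq : ‖q‖ < 1) : phi q * (1 - paramW q) = phi (q ^ 5) * (1 + paramW q) := by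
  refine (convex_ball (0 : ℂ) 1).isPreconnected.eq_of_sq_eq
    (f := fun q => phi q * (1 - paramW q)) (g := fun q => phi (q ^ 5) * (1 + paramW q))
    (continuousOn_phi.mul (continuousOn_const.sub continuousOn_paramW))
    ((ContinuousOn.comp_pow continuousOn_phi (by norm_num)).mul
      (continuousOn_const.add continuousOn_paramW)) (fun z hz => ?_) (fun {z} hz => ?_)
    (y := 0) (by simp) (by simp [paramW]) (by simpa using hq)
  · exact phi_five_sq_mul (by simpa using hz)
  · have hz' : ‖z‖ < 1 := by simpa using hz
    exact mul_ne_zero (phi_ne_zero (norm_pow_lt_one hz' (by norm_num))) (one_add_paramW_ne_zero hz')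

end

/-! ### The three modular equations -/

section

variable {q : ℂ}

/-- The `5`-dissection of `φ(q) / φ(q ^ 5)` in terms of `R(q ^ 5)` and `R(q ^ 20)`. -/
lemma phi_mul_eq (hq0 : q ≠ 0) (hq : ‖q‖ < 1) {a c : ℂ} (ha : a = q * rrProd (q ^ 5))
    (hc : c = q ^ 4 * rrProd (q ^ 20)) :
    phi q * (1 + a * c) = phi (q ^ 5) * (1 + 2 * a + 2 * c - a * c) := by
  have hQ0 : q ^ 5 ≠ 0 := pow_ne_zero 5 hq0
  have hQ : ‖q ^ 5‖ < 1 := norm_pow_lt_one hq (by norm_num)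
  have h0 := phi_dissect hq0 hq
  have h1 := ramTheta_three_seven_eq hQ0 hQ
  have h2 := ramTheta_one_nine_eq hQ0 hQ
  have h3 := phi_five_mul hQ
  have hw : paramW (q ^ 5) = a * c := by
    rw [paramW, ha, hc, ← pow_mul]
    ring
  rw [hw] at h1 h2 h3
  simp only [← pow_mul, Nat.reduceMul] at h1 h2 h3
  rw [ha, hc] at *
  linear_combination (1 + q * rrProd (q ^ 5) * (q ^ 4 * rrProd (q ^ 20))) * h0 - h3 +
    2 * q * h1 + 2 * q ^ 4 * h2

/-- `phi_mul_eq` and `phi_five_mul` both give `φ(q) / φ(q ^ 5)`; comparing them yields `w`. -/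
lemma paramW_modular (hq : ‖q‖ < 1) {a c : ℂ} (ha : a = q * rrProd (q ^ 5))
    (hc : c = q ^ 4 * rrProd (q ^ 20)) :
    1 + a + c ≠ 0 ∧ paramW q = (a + c - a * c) / (1 + a + c) := by
  rcases eq_or_ne q 0 with rfl | hq0
  · simp [paramW, ha, hc]
  have hQ : ‖q ^ 5‖ < 1 := norm_pow_lt_one hq (by norm_num)
  have hP := phi_ne_zero hQ
  have h1 := phi_five_mul hq
  have h2 : (1 + paramW q) * (1 + a * c) = (1 - paramW q) * (1 + 2 * a + 2 * c - a * c) := by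
    refine mul_left_cancel₀ hP ?_
    linear_combination (1 - paramW q) * phi_mul_eq hq0 hq ha hc - (1 + a * c) * h1
  have hac : 1 + a * c ≠ 0 := by
    have h := one_add_paramW_ne_zero hQ
    rw [paramW, ← pow_mul] at h
    convert h using 2
    rw [ha, hc]
    ring
  have h3 : (1 - paramW q) * (1 + a + c) = 1 + a * c := by linear_combination -h2 / 2
  have h4 : 1 + a + c ≠ 0 := right_ne_zero_of_mul (h3 ▸ hac)
  refine ⟨h4, ?_⟩
  rw [eq_div_iff h4]
  linear_combination -h3

/-- The `5`-dissection of `ψ(q ^ 2) / (q ψ(q ^ 10))` in terms of `a = R(q ^ 5)` and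
`M = R(q ^ 5) ^ 2 R(q ^ 10) / R(q ^ 20)`. -/
lemma psi_two_mul_eq (hq0 : q ≠ 0) (hq : ‖q‖ < 1) {a M : ℂ} (ha : a = q * rrProd (q ^ 5))
    (hM : M = paramM (q ^ 5)) :
    psi (q ^ 2) * (1 + M) * a = q * psi (q ^ 10) * (2 * M + 2 * a ^ 2 + a * (1 - M)) := by
  have hQ0 : q ^ 5 ≠ 0 := pow_ne_zero 5 hq0
  have hQ : ‖q ^ 5‖ < 1 := norm_pow_lt_one hq (by norm_num)
  have h0 := psi_dissect (pow_ne_zero 2 hq0) (norm_sq_lt_one hq)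
  have h1 := ramTheta_four_six_mul hQ0 hQ
  have h2 := ramTheta_two_eight_mul hQ0 hQ
  have h3 := psi_ten_mul hQ0 hQ
  rw [← hM] at h1 h2 h3
  simp only [← pow_mul, Nat.reduceMul] at h0 h1 h2 h3
  rw [ha]
  linear_combination (1 + M) * q * rrProd (q ^ 5) * h0 + q * h1 + q ^ 3 * rrProd (q ^ 5) * h2 +
    q ^ 2 * rrProd (q ^ 5) * h3

/-- `psi_two_mul_eq` and `psi_ten_mul` both give `ψ(q ^ 2) / (q ψ(q ^ 10))`; comparing them yields
`m`. -/
lemma paramM_modular (hq0 : q ≠ 0) (hq : ‖q‖ < 1) {a b c : ℂ} (ha : a = q * rrProd (q ^ 5))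
    (hb : b = q ^ 2 * rrProd (q ^ 10)) (hc : c = q ^ 4 * rrProd (q ^ 20)) :
    a * b + c + a * c ≠ 0 ∧
      paramM q = a * ((b - a * b + c) / (a * b + c + a * c)) := by
  have hQ0 : q ^ 5 ≠ 0 := pow_ne_zero 5 hq0
  have hr : ∀ n, n ≠ 0 → rrProd (q ^ n) ≠ 0 := fun n hn => rrProd_ne_zero (norm_pow_lt_one hq hn)
  have hQ : ‖q ^ 5‖ < 1 := norm_pow_lt_one hq (by norm_num)
  have ha0 : a ≠ 0 := ha ▸ mul_ne_zero hq0 (hr 5 (by norm_num))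
  have hc0 : c ≠ 0 := hc ▸ mul_ne_zero (pow_ne_zero 4 hq0) (hr 20 (by norm_num))
  have hP : psi (q ^ 10) ≠ 0 := psi_ne_zero (norm_pow_lt_one hq (by norm_num))
  obtain ⟨M, hM⟩ : ∃ M, M = paramM (q ^ 5) := ⟨_, rfl⟩
  have hMc : M * c = a ^ 2 * b := by
    have h20 := hr 20 (by norm_num)
    rw [hM, ha, hb, hc, paramM, ← pow_mul, ← pow_mul]
    field_simp
  have h1 : 1 + M ≠ 0 := hM ▸ one_add_paramM_ne_zero hQ0 hQ
  have h2 := psi_ten_mul hq0 hq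
  have h3 : a * (1 + paramM q) * (1 + M) =
      (1 - paramM q) * (2 * M + 2 * a ^ 2 + a * (1 - M)) := by
    refine mul_left_cancel₀ (mul_ne_zero hq0 hP) ?_
    linear_combination (1 - paramM q) * psi_two_mul_eq hq0 hq ha hM + (1 + M) * a * h2
  have h4 : (1 + paramM q) * (c + a ^ 2 * b) =
      (1 - paramM q) * (c - a ^ 2 * b + 2 * a * b + 2 * a * c) := by
    refine mul_left_cancel₀ ha0 ?_
    linear_combination c * h3 - (a * (1 + paramM q) +
      (1 - paramM q) * (a - 2)) * hMc
  have h5 : (1 - paramM q) * (a * b + c + a * c) = c + a ^ 2 * b := by linear_combination -h4 / 2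
  have h6 : c + a ^ 2 * b ≠ 0 := by
    rw [← hMc]
    have := mul_ne_zero h1 hc0
    rwa [add_mul, one_mul] at this
  have h7 : a * b + c + a * c ≠ 0 := right_ne_zero_of_mul (h5 ▸ h6)
  refine ⟨h7, ?_⟩
  rw [mul_div_assoc', eq_div_iff h7]
  linear_combination -h5

/-- The `5`-dissection of `ψ(q) / (q ^ 3 ψ(q ^ 25))` in terms of `a = R(q ^ 5)` and
`b = R(q ^ 10)`. -/
lemma psi_mul_eq (hq0 : q ≠ 0) (hq : ‖q‖ < 1) {a b : ℂ} (ha : a = q * rrProd (q ^ 5))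
    (hb : b = q ^ 2 * rrProd (q ^ 10)) :
    psi q * (a * b) = q ^ 3 * psi (q ^ 25) * (1 + a + a * b - a * b ^ 2 + a ^ 2 * b ^ 2) := by
  have hQ0 : q ^ 5 ≠ 0 := pow_ne_zero 5 hq0
  have hQ : ‖q ^ 5‖ < 1 := norm_pow_lt_one hq (by norm_num)
  have h0 := psi_dissect hq0 hq
  have h1 := ramTheta_two_three_mul hQ0 hQ
  have h2 := ramTheta_one_four_mul hQ0 hQ
  have hk : paramK (q ^ 5) = a * b ^ 2 := by
    rw [paramK, ha, hb, ← pow_mul]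
    ring
  rw [hk] at h1 h2
  simp only [← pow_mul, Nat.reduceMul] at h1 h2
  rw [ha, hb] at *
  linear_combination (q ^ 3 * rrProd (q ^ 5) * rrProd (q ^ 10)) * h0 + q ^ 3 * h1 +
    q ^ 4 * rrProd (q ^ 5) * h2

/-- By `psi_sq_mul_paramK` at `q` and at `q ^ 5`, the product of `1 / k + 1 - k` with its value at
`q ^ 5` is `ψ(q) ^ 2 / (q ^ 6 ψ(q ^ 25) ^ 2)`, which `psi_mul_eq` evaluates. -/
lemma paramK_modular (hq0 : q ≠ 0) (hq : ‖q‖ < 1) {a b : ℂ} (ha : a = q * rrProd (q ^ 5))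
    (hb : b = q ^ 2 * rrProd (q ^ 10)) :
    paramK q ≠ 0 ∧ rrD a b ≠ 0 ∧ 1 / paramK q - paramK q = rrN a b / rrD a b := by
  have hQ0 : q ^ 5 ≠ 0 := pow_ne_zero 5 hq0
  have hr : ∀ n, n ≠ 0 → rrProd (q ^ n) ≠ 0 := fun n hn => rrProd_ne_zero (norm_pow_lt_one hq hn)
  have hQ : ‖q ^ 5‖ < 1 := norm_pow_lt_one hq (by norm_num)
  have ha0 : a ≠ 0 := ha ▸ mul_ne_zero hq0 (hr 5 (by norm_num))
  have hb0 : b ≠ 0 := hb ▸ mul_ne_zero (pow_ne_zero 2 hq0) (hr 10 (by norm_num))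
  have hk0 : paramK q ≠ 0 := mul_ne_zero (mul_ne_zero hq0 (rrProd_ne_zero hq))
    (pow_ne_zero 2 (hr 2 (by norm_num)))
  have hP5 := psi_ne_zero hQ
  have hP25 : psi (q ^ 25) ≠ 0 := psi_ne_zero (norm_pow_lt_one hq (by norm_num))
  have hk : paramK (q ^ 5) = a * b ^ 2 := by
    rw [paramK, ha, hb, ← pow_mul]
    ring
  have h1 := psi_sq_mul_paramK hq0 hq
  have h2 := psi_sq_mul_paramK hQ0 hQ
  rw [hk, ← pow_mul] at h2
  have h3 := psi_mul_eq hq0 hq ha hb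
  have hD : rrD a b ≠ 0 := by
    refine mul_ne_zero ha0 ?_
    have h := mul_ne_zero (pow_ne_zero 2 hP5) (mul_ne_zero ha0 (pow_ne_zero 2 hb0))
    rw [h2] at h
    convert right_ne_zero_of_mul h using 1
    ring
  have h4 : (1 + a + a * b - a * b ^ 2 + a ^ 2 * b ^ 2) ^ 2 * paramK q =
      rrD a b * (1 + paramK q - paramK q ^ 2) := by
    refine mul_left_cancel₀ (mul_ne_zero (mul_ne_zero (pow_ne_zero 6 hq0) (pow_ne_zero 2 hP25))
      (mul_ne_zero ha0 (pow_ne_zero 2 hb0))) ?_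
    rw [rrD]
    linear_combination (-(a * b ^ 2) * paramK q * (psi q * (a * b) + q ^ 3 * psi (q ^ 25) *
        (1 + a + a * b - a * b ^ 2 + a ^ 2 * b ^ 2))) * h3 + a ^ 2 * b ^ 2 * (a * b ^ 2) * h1 +
      a ^ 2 * b ^ 2 * q * (1 + paramK q - paramK q ^ 2) * h2
  -- The numerator is a difference of which only the square comes from `ψ(q) ^ 2`.
  have h5 : rrN a b = (1 + a + a * b - a * b ^ 2 + a ^ 2 * b ^ 2) ^ 2 - rrD a b := by
    rw [rrN, rrD]
    ring
  refine ⟨hk0, hD, ?_⟩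
  rw [h5]
  field_simp
  linear_combination -h4

end

lemma rrR_eq {q : ℂ} (hq : ‖q‖ < 1) (t : ℂ) {n : ℕ} (hn : n ≠ 0) :
    rrR q t n = t ^ n * rrProd (q ^ n) := by
  rw [rrR, rrValue_eq_rrProd (norm_pow_lt_one hq hn)]

end RogersRamanujan

open RogersRamanujan in
theorem theorem1p1 (q t : ℂ) (hq : ‖q‖ < 1) (ht : t ^ 5 = q) :
    -- the continued fractions that define `R(q ^ n)` converge
    (∀ n : ℕ, 1 ≤ n → Tendsto (rrFraction (q ^ n)).convs atTop (𝓝 (rrValue (q ^ n)))) ∧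
    -- the first identity
    (1 + rrR q t 5 + rrR q t 20 ≠ 0 ∧
      rrR q t 1 * rrR q t 4 =
        (rrR q t 5 + rrR q t 20 - rrR q t 5 * rrR q t 20) / (1 + rrR q t 5 + rrR q t 20)) ∧
    (q ≠ 0 →
      -- the second identity
      (rrR q t 4 ≠ 0 ∧
        rrR q t 5 * rrR q t 10 + rrR q t 20 + rrR q t 5 * rrR q t 20 ≠ 0 ∧
        rrR q t 1 ^ 2 * rrR q t 2 / rrR q t 4 =
          rrR q t 5 * ((rrR q t 10 - rrR q t 5 * rrR q t 10 + rrR q t 20) /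
            (rrR q t 5 * rrR q t 10 + rrR q t 20 + rrR q t 5 * rrR q t 20))) ∧
      -- the third identity
      (rrR q t 1 * rrR q t 2 ^ 2 ≠ 0 ∧
        rrD (rrR q t 5) (rrR q t 10) ≠ 0 ∧
        1 / (rrR q t 1 * rrR q t 2 ^ 2) - rrR q t 1 * rrR q t 2 ^ 2 =
          rrN (rrR q t 5) (rrR q t 10) / rrD (rrR q t 5) (rrR q t 10))) := by
  have h5 : rrR q t 5 = q * rrProd (q ^ 5) := by rw [rrR_eq hq t (by norm_num), ht]
  have h10 : rrR q t 10 = q ^ 2 * rrProd (q ^ 10) := by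
    rw [rrR_eq hq t (by norm_num), ← ht]
    ring
  have h20 : rrR q t 20 = q ^ 4 * rrProd (q ^ 20) := by
    rw [rrR_eq hq t (by norm_num), ← ht]
    ring
  have h1 : rrR q t 1 = t * rrProd q := by rw [rrR_eq hq t one_ne_zero, pow_one, pow_one]
  have h2 : rrR q t 2 = t ^ 2 * rrProd (q ^ 2) := rrR_eq hq t (by norm_num)
  have h4 : rrR q t 4 = t ^ 4 * rrProd (q ^ 4) := rrR_eq hq t (by norm_num)
  have hw : rrR q t 1 * rrR q t 4 = paramW q := by
    rw [h1, h4, paramW]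
    linear_combination rrProd q * rrProd (q ^ 4) * ht
  have hk : rrR q t 1 * rrR q t 2 ^ 2 = paramK q := by
    rw [h1, h2, paramK]
    linear_combination rrProd q * rrProd (q ^ 2) ^ 2 * ht
  refine ⟨fun n hn => ?_, ?_, fun hq0 => ?_⟩
  · have hqn := norm_pow_lt_one hq (n := n) (by lia)
    rw [rrValue_eq_rrProd hqn]
    exact tendsto_rrFraction_rrProd hqn
  · rw [hw]
    exact paramW_modular hq h5 h20
  · have ht0 : t ≠ 0 := by
      rintro rfl
      exact hq0 (by rw [← ht, zero_pow (by norm_num)])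
    have hr4 := rrProd_ne_zero (norm_pow_lt_one hq (n := 4) (by norm_num))
    have hm : rrR q t 1 ^ 2 * rrR q t 2 / rrR q t 4 = paramM q := by
      rw [h1, h2, h4, paramM]
      field_simp
    rw [hm, hk]
    refine ⟨⟨?_, paramM_modular hq0 hq h5 h10 h20⟩, paramK_modular hq0 hq h5 h10⟩
    rw [h4]
    exact mul_ne_zero (pow_ne_zero 4 ht0) hr4
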